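/- Consider the affine probabilistic $\lambda$-calculus with pairs, with terms $$M ::= x \mid \lambda x.M \mid MM \mid M\oplus M \mid \Omega \mid \langle M,M\rangle \mid \mathtt{let}\ \langle x,y\rangle = M\ \mathtt{in}\ M .$$ *Types and programs.* Fix a type system: a set of types in which every type unfolds to exactly one of the forms: an atom, $\sigma\multimap\tau$, or $\sigma\otimes\tau$, and such that for all types $\sigma,\tau$ some type unfolds to $\sigma\multimap\tau$ (for instance simple types, recursive types, or the single type $*=*\multimap *$, which types exactly the affine terms without pairs). Terms are typed by the usual affine rules: types are identified with their unfolding; application, pairing and $\mathtt{let}$ split the environment into disjoint parts; both branches of $\oplus$ share the environment; $\Omega$ has every type; weakening is allowed. A program of type $\theta$ is a closed term of type $\theta$. Values are closed abstractions and closed pairs. *Semantics.* Every program $M$ evaluates, call-by-value, to a unique finite value subdistribution $[\![M]\!]$: $[\![\Omega]\!]=0$; $[\![V]\!]$ is the Dirac distribution for a value $V$; $[\![M\oplus N]\!]=\frac12[\![M]\!]+\frac12[\![N]\!]$; $[\![MN]\!]=\sum [\![M]\!](\lambda x.L)\,[\![N]\!](V)\,[\![L\{V/x\}]\!]$; and $[\![\mathtt{let}\,\langle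 x,y\rangle=M\ \mathtt{in}\ N]\!]=\sum [\![M]\!](\langle L,K\rangle)\,[\![L]\!](V)\,[\![K]\!](W)\,[\![N\{V/x,W/y\}]\!]$. Write $|\mathscr D|$ for the total weight of a distribution $\mathscr D$. *Context distance.* For programs $M,N$ of type $\theta$, $\delta^{\mathrm{ctx}}(M,N)=\sup_{\mathcal C}\bigl|\,|[\![\mathcal C[M]]\!]|-|[\![\mathcal C[N]]\!]|\,\bigr|$ over all closed typed affine contexts $\mathcal C$, of any type, with a hole of type $\theta$ (the hole may occur in both branches of a choice, and otherwise occurs at most once). *Trace distance.* A trace is a finite sequence of actions $@V$ ($V$ a closed value) and $\otimes L$ ($L$ a term with free variables among $x,y$). The probability of accepting a trace is given by $\Pr(M,s)=\sum_V[\![M]\!](V)\Pr(V,s)$ and, on values, $\Pr(V,\varepsilon)=1$, $\Pr(\lambda x.M,\,@V\cdot s)=\Pr(M\{V/x\},s)$, $\Pr(\langle M,N\rangle,\otimes L\cdot s)=\sum_{V,W}[\![M]\!](V)[\![N]\!](W)\Pr(L\{V/x,W/y\},s)$. Then $\delta^{\mathrm{tr}}(M,N)=\sup_s|\Pr(M,s)-\Pr(N,s)|$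 over the traces that are well typed for the type of $M,N$. *Tuple distance.* Consider the labelled Markov chain whose states are tuples $\langle V_1,\dots,V_n\rangle$ of values. Its actions are: - $\mathrm{cut}_i$, enabled when $V_i=\langle N,L\rangle$ is a pair: it replaces the component $V_i$ by two components $V,W$ with probability $[\![N]\!](V)\,[\![L]\!](W)$. - $(\Gamma,\mathcal C)@i$, enabled when $V_i=\lambda y.N$: here $\Gamma\subseteq\{x_j\mid j\le n,\ j\ne i\}$ and $\mathcal C$ is an open term, typed in $\Gamma$, that is a variable, an abstraction or a pair. It removes the components $V_j$ with $x_j\in\Gamma$ and replaces $V_i$ by $W$ with probability $[\![N\{\mathcal C\{V_j/x_j\}_{x_j\in\Gamma}/y\}]\!](W)$. A tuple trace is a finite word $s$ of actions, well typed for the types of the components; it succeeds from a tuple $K$ with probability $\Pr(K,\varepsilon)=1$, $\Pr(K,a\cdot s)=\sum_H P(K,a)(H)\Pr(H,s)$, where $P(K,a)(H)$ is the probability that action $a$ leads from $K$ to $H$. For programs $M,N$ of the same type put $$\delta^{\mathrm{mul}}(M,N)=\sup_s\Bigl|\sum_V[\![M]\!](V)\Pr(\langle V\rangle,s)-\sum_W[\![N]\!](W)\Pr(\langle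 W\rangle,s)\Bigr| .$$ **Theorem.** For every such type system and all programs $M,N$ of the same type, $$\delta^{\mathrm{mul}}(M,N)=\delta^{\mathrm{ctx}}(M,N)\qquad\text{and}\qquad \delta^{\mathrm{mul}}(M,N)=\delta^{\mathrm{tr}}(M,N).$$ -/

import Mathlib

noncomputable section

namespace AffineLambda

/-! ## Terms

Terms of the probabilistic lambda-calculus with pairs, up to renaming of bound variables
(de Bruijn indices). In `letp M N`, i.e. `let ⟨x, y⟩ = M in N`, the index `0` of `N` is `x`
and the index `1` of `N` is `y`. -/

inductive Term : Type where
  | var : ℕ → Term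
  | lam : Term → Term
  | app : Term → Term → Term
  | choice : Term → Term → Term
  | omega : Term
  | pair : Term → Term → Term
  | letp : Term → Term → Term

namespace Term

/-- Lift a renaming under one binder. -/
def liftRen (r : ℕ → ℕ) : ℕ → ℕ
  | 0 => 0
  | n + 1 => r n + 1

def rename : (ℕ → ℕ) → Term → Term
  | r, var n => var (r n)
  | r, lam M => lam (rename (liftRen r) M)
  | r, app M N => app (rename r M) (rename r N)
  | r, choice M N => choice (rename r M) (rename r N)
  | _, omega => omega
  | r, pair M N => pair (rename r M) (rename r N)
  | r, letp M N => letp (rename r M) (rename (liftRen (liftRen r)) N)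

/-- Lift a substitution under one binder. -/
def up (s : ℕ → Term) : ℕ → Term
  | 0 => var 0
  | n + 1 => rename Nat.succ (s n)

/-- Simultaneous capture-avoiding substitution. -/
def subst : (ℕ → Term) → Term → Term
  | s, var n => s n
  | s, lam M => lam (subst (up s) M)
  | s, app M N => app (subst s M) (subst s N)
  | s, choice M N => choice (subst s M) (subst s N)
  | _, omega => omega
  | s, pair M N => pair (subst s M) (subst s N)
  | s, letp M N => letp (subst s M) (subst (up (up s)) N)

/-- `scons V s` sends the index `0` to `V` and the index `n + 1` to `s n`. -/
def scons (V : Term) (s : ℕ → Term) : ℕ → Term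
  | 0 => V
  | n + 1 => s n

/-- `M{V/x}`, where `x` is the index `0` of `M`. -/
def inst (M V : Term) : Term := subst (scons V var) M

/-- `M{V/x, W/y}`, where `x`, `y` are the indices `0`, `1` of `M`. -/
def inst₂ (M V W : Term) : Term := subst (scons V (scons W var)) M

/-- Values among closed terms: abstractions and pairs (of arbitrary terms). -/
def IsValue : Term → Prop
  | lam _ => True
  | pair _ _ => True
  | _ => False

/-- Open terms that become values whenever values are substituted for their free variables:
variables, abstractions and pairs. -/
def IsOpenValue : Term → Prop
  | var _ => True
  | lam _ => True
  | pair _ _ => True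
  | _ => False

end Term

open Term

/-! ## Affine types and affine typing -/

/-- The possible forms of a type: an atom, `σ ⊸ τ`, or `σ ⊗ τ`. -/
inductive Shape (Ty : Type*) where
  | atom : Shape Ty
  | arrow : Ty → Ty → Shape Ty
  | tensor : Ty → Ty → Shape Ty

/-- A system of (possibly recursive) types: every type unfolds to exactly one form, and any two
types have an affine function type. Since the form of a type is unique, a typed program never
applies a pair nor splits a function. Simple types and recursive types with
`μX.σ = σ[μX.σ/X]` are of this kind. So is the one-point system whose only type unfolds to
`* ⊸ *`, which types exactly the affine terms without pairs. -/
structure TypeSystem (Ty : Type*) where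
  unfold : Ty → Shape Ty
  exists_arrow : ∀ σ τ, ∃ ρ, unfold ρ = Shape.arrow σ τ

/-- Typing environments: partial maps from variables to types. -/
abbrev Env (Ty : Type*) := ℕ → Option Ty

namespace Env

def empty {Ty : Type*} : Env Ty := fun _ => none

/-- `Γ, x : σ`, where `x` is the new index `0`. -/
def cons {Ty : Type*} (σ : Ty) (Γ : Env Ty) : Env Ty
  | 0 => some σ
  | n + 1 => Γ n

/-- `Γ` is the union of the environments `Δ` and `Θ`, which have disjoint domains. -/
def Split {Ty : Type*} (Γ Δ Θ : Env Ty) : Prop :=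
  ∀ n, (Δ n = Γ n ∧ Θ n = none) ∨ (Δ n = none ∧ Θ n = Γ n)

end Env

/-- The affine typing judgement `Γ ⊢ M : τ`. -/
inductive HasType {Ty : Type*} (T : TypeSystem Ty) : Env Ty → Term → Ty → Prop where
  | var {Γ : Env Ty} {n : ℕ} {τ : Ty} : Γ n = some τ → HasType T Γ (var n) τ
  | lam {Γ : Env Ty} {M : Term} {ρ σ τ : Ty} :
      T.unfold ρ = Shape.arrow σ τ → HasType T (Env.cons σ Γ) M τ → HasType T Γ (lam M) ρ
  | app {Γ Δ Θ : Env Ty} {M N : Term} {ρ σ τ : Ty} :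
      Env.Split Γ Δ Θ → T.unfold ρ = Shape.arrow σ τ →
      HasType T Δ M ρ → HasType T Θ N σ → HasType T Γ (app M N) τ
  | choice {Γ : Env Ty} {M N : Term} {τ : Ty} :
      HasType T Γ M τ → HasType T Γ N τ → HasType T Γ (choice M N) τ
  | omega {Γ : Env Ty} {τ : Ty} : HasType T Γ omega τ
  | pair {Γ Δ Θ : Env Ty} {M N : Term} {ρ σ τ : Ty} :
      Env.Split Γ Δ Θ → T.unfold ρ = Shape.tensor σ τ →
      HasType T Δ M σ → HasType T Θ N τ → HasType T Γ (pair M N) ρ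
  | letp {Γ Δ Θ : Env Ty} {M N : Term} {ρ σ τ γ : Ty} :
      Env.Split Γ Δ Θ → T.unfold ρ = Shape.tensor σ τ →
      HasType T Δ M ρ → HasType T (Env.cons σ (Env.cons τ Θ)) N γ → HasType T Γ (letp M N) γ

/-- Programs of type `σ`: closed terms of type `σ`. -/
def IsProgram {Ty : Type*} (T : TypeSystem Ty) (σ : Ty) (M : Term) : Prop :=
  HasType T Env.empty M σ

/-! ## Big-step semantics -/

/-- `∑ a, D a • f a`. -/
def bind {α β : Type*} (D : α →₀ ℝ) (f : α → β →₀ ℝ) : β →₀ ℝ := D.sum fun a p => p • f a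

/-- `∑ a, D a * f a`. -/
def expect {α : Type*} (D : α →₀ ℝ) (f : α → ℝ) : ℝ := D.sum fun a p => p * f a

/-- The weight `∑ a, D a`. -/
def weight {α : Type*} (D : α →₀ ℝ) : ℝ := D.sum fun _ p => p

/-- Call-by-value evaluation of a closed term to a finite value distribution. -/
inductive BigStep : Term → (Term →₀ ℝ) → Prop where
  | omega : BigStep omega 0
  | value {V : Term} : IsValue V → BigStep V (Finsupp.single V 1)
  | choice {M N : Term} {D E : Term →₀ ℝ} :
      BigStep M D → BigStep N E → BigStep (choice M N) ((1 / 2 : ℝ) • D + (1 / 2 : ℝ) • E)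
  | app {M N : Term} {D E : Term →₀ ℝ} {F : Term → Term → Term →₀ ℝ} :
      BigStep M D → BigStep N E →
      (∀ L V, lam L ∈ D.support → V ∈ E.support → BigStep (inst L V) (F L V)) →
      BigStep (app M N)
        (bind D fun U => match U with
          | lam L => bind E fun V => F L V
          | _ => 0)
  | letp {M N : Term} {D : Term →₀ ℝ} {F G : Term → Term →₀ ℝ} {E : Term → Term → Term →₀ ℝ} :
      BigStep M D →
      (∀ L K, pair L K ∈ D.support → BigStep L (F L)) →
      (∀ L K, pair L K ∈ D.support → BigStep K (G K)) →
      (∀ L K V W, pair L K ∈ D.support → V ∈ (F L).support → W ∈ (G K).support →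
        BigStep (inst₂ N V W) (E V W)) →
      BigStep (letp M N)
        (bind D fun U => match U with
          | pair L K => bind (F L) fun V => bind (G K) fun W => E V W
          | _ => 0)

open Classical in
/-- The value distribution of `M`: the distribution that `M` evaluates to (a program evaluates to
exactly one). -/
def sem (M : Term) : Term →₀ ℝ := if h : ∃ D, BigStep M D then h.choose else 0

/-- The probability of convergence of `M`. -/
def conv (M : Term) : ℝ := weight (sem M)

/-! ## Context distance -/

/-- Contexts. The hole is filled with closed terms; it may occur in both branches of a
probabilistic choice, and otherwise occurs at most once. -/
inductive Ctx : Type where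
  | hole : Ctx
  | term : Term → Ctx
  | lam : Ctx → Ctx
  | appL : Ctx → Term → Ctx
  | appR : Term → Ctx → Ctx
  | choice : Ctx → Ctx → Ctx
  | pairL : Ctx → Term → Ctx
  | pairR : Term → Ctx → Ctx
  | letL : Ctx → Term → Ctx
  | letR : Term → Ctx → Ctx

/-- Filling the hole with a closed term. -/
def Ctx.fill : Ctx → Term → Term
  | .hole, P => P
  | .term M, _ => M
  | .lam C, P => Term.lam (C.fill P)
  | .appL C M, P => Term.app (C.fill P) M
  | .appR M C, P => Term.app M (C.fill P)
  | .choice C C', P => Term.choice (C.fill P) (C'.fill P)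
  | .pairL C M, P => Term.pair (C.fill P) M
  | .pairR M C, P => Term.pair M (C.fill P)
  | .letL C M, P => Term.letp (C.fill P) M
  | .letR M C, P => Term.letp M (C.fill P)

/-- `CtxHasType T θ Γ C τ`: the affine context `C`, with a hole of type `θ`, has type `τ` in the
environment `Γ`. -/
inductive CtxHasType {Ty : Type*} (T : TypeSystem Ty) (θ : Ty) : Env Ty → Ctx → Ty → Prop where
  | hole {Γ : Env Ty} : CtxHasType T θ Γ Ctx.hole θ
  | term {Γ : Env Ty} {M : Term} {τ : Ty} : HasType T Γ M τ → CtxHasType T θ Γ (Ctx.term M) τ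
  | lam {Γ : Env Ty} {C : Ctx} {ρ σ τ : Ty} :
      T.unfold ρ = Shape.arrow σ τ → CtxHasType T θ (Env.cons σ Γ) C τ →
      CtxHasType T θ Γ (Ctx.lam C) ρ
  | appL {Γ Δ Θ : Env Ty} {C : Ctx} {N : Term} {ρ σ τ : Ty} :
      Env.Split Γ Δ Θ → T.unfold ρ = Shape.arrow σ τ →
      CtxHasType T θ Δ C ρ → HasType T Θ N σ → CtxHasType T θ Γ (Ctx.appL C N) τ
  | appR {Γ Δ Θ : Env Ty} {M : Term} {C : Ctx} {ρ σ τ : Ty} :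
      Env.Split Γ Δ Θ → T.unfold ρ = Shape.arrow σ τ →
      HasType T Δ M ρ → CtxHasType T θ Θ C σ → CtxHasType T θ Γ (Ctx.appR M C) τ
  | choice {Γ : Env Ty} {C C' : Ctx} {τ : Ty} :
      CtxHasType T θ Γ C τ → CtxHasType T θ Γ C' τ → CtxHasType T θ Γ (Ctx.choice C C') τ
  | pairL {Γ Δ Θ : Env Ty} {C : Ctx} {N : Term} {ρ σ τ : Ty} :
      Env.Split Γ Δ Θ → T.unfold ρ = Shape.tensor σ τ →
      CtxHasType T θ Δ C σ → HasType T Θ N τ → CtxHasType T θ Γ (Ctx.pairL C N) ρ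
  | pairR {Γ Δ Θ : Env Ty} {M : Term} {C : Ctx} {ρ σ τ : Ty} :
      Env.Split Γ Δ Θ → T.unfold ρ = Shape.tensor σ τ →
      HasType T Δ M σ → CtxHasType T θ Θ C τ → CtxHasType T θ Γ (Ctx.pairR M C) ρ
  | letL {Γ Δ Θ : Env Ty} {C : Ctx} {N : Term} {ρ σ τ γ : Ty} :
      Env.Split Γ Δ Θ → T.unfold ρ = Shape.tensor σ τ →
      CtxHasType T θ Δ C ρ → HasType T (Env.cons σ (Env.cons τ Θ)) N γ →
      CtxHasType T θ Γ (Ctx.letL C N) γ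
  | letR {Γ Δ Θ : Env Ty} {M : Term} {C : Ctx} {ρ σ τ γ : Ty} :
      Env.Split Γ Δ Θ → T.unfold ρ = Shape.tensor σ τ →
      HasType T Δ M ρ → CtxHasType T θ (Env.cons σ (Env.cons τ Θ)) C γ →
      CtxHasType T θ Γ (Ctx.letR M C) γ

/-- The context distance between programs of type `θ`: the supremum, taken in `[0, ∞]`, of
`|conv C[M] - conv C[N]|` over all closed contexts `C` of any type with a hole of type `θ`. -/
def ctxDist {Ty : Type*} (T : TypeSystem Ty) (θ : Ty) (M N : Term) : ENNReal :=
  ⨆ (C : Ctx) (_ : ∃ τ, CtxHasType T θ Env.empty C τ),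
    ENNReal.ofReal |conv (C.fill M) - conv (C.fill N)|

/-! ## Trace distance -/

/-- Actions of traces: `appl V` passes the value `V` to a function, and `tens L` substitutes
the values of the two components of a pair for the free variables `0`, `1` of `L`. -/
inductive TrAct : Type where
  | appl : Term → TrAct
  | tens : Term → TrAct

/-- The probability that a value accepts a trace. -/
def valueTrProb : List TrAct → Term → ℝ
  | [], _ => 1
  | TrAct.appl W :: s, lam M => expect (sem (inst M W)) (valueTrProb s)
  | TrAct.tens L :: s, pair M N =>
      expect (sem M) fun V => expect (sem N) fun W =>
        expect (sem (inst₂ L V W)) (valueTrProb s)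
  | _ :: _, _ => 0

/-- The probability that a program accepts a trace. -/
def trProb (M : Term) (s : List TrAct) : ℝ := expect (sem M) (valueTrProb s)

/-- The traces that can be performed on programs of a given type. -/
inductive TraceTyped {Ty : Type*} (T : TypeSystem Ty) : Ty → List TrAct → Prop where
  | nil {ρ : Ty} : TraceTyped T ρ []
  | appl {ρ σ τ : Ty} {V : Term} {s : List TrAct} :
      T.unfold ρ = Shape.arrow σ τ → IsValue V → IsProgram T σ V → TraceTyped T τ s →
      TraceTyped T ρ (TrAct.appl V :: s)
  | tens {ρ σ τ γ : Ty} {L : Term} {s : List TrAct} :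
      T.unfold ρ = Shape.tensor σ τ → HasType T (Env.cons σ (Env.cons τ Env.empty)) L γ →
      TraceTyped T γ s → TraceTyped T ρ (TrAct.tens L :: s)

/-- The trace distance between programs of type `θ`. -/
def trDist {Ty : Type*} (T : TypeSystem Ty) (θ : Ty) (M N : Term) : ENNReal :=
  ⨆ (s : List TrAct) (_ : TraceTyped T θ s), ENNReal.ofReal |trProb M s - trProb N s|

/-! ## Tuple distance -/

/-- Actions on tuples: `cut i` splits the pair in position `i`; `appl G C i` passes to the function
in position `i` the argument obtained from the open value `C`, whose free variables lie in `G`, by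
substituting for each variable `j` in `G` the component in position `j`. Positions count
from `0`. -/
inductive TupAct : Type where
  | cut : ℕ → TupAct
  | appl : Finset ℕ → Term → ℕ → TupAct

/-- Replace the component in position `i` by `a` and `b`. -/
def splitAt {α : Type*} (K : List α) (i : ℕ) (a b : α) : List α :=
  K.take i ++ a :: b :: K.drop (i + 1)

/-- Replace the component in position `i` by `a` and delete those in the positions in `G`. -/
def contractAt {α : Type*} (K : List α) (G : Finset ℕ) (i : ℕ) (a : α) : List α :=
  (List.range K.length).filterMap fun j =>
    if j = i then some a else if j ∈ G then none else K[j]?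

/-- Substitute for each variable `j` the component in position `j`. -/
def substTuple (C : Term) (K : List Term) : Term := subst (fun j => (K[j]?).getD (var j)) C

/-- The transition probabilities of the Markov chain of tuples of values. -/
def tupStep (K : List Term) : TupAct → (List Term →₀ ℝ)
  | TupAct.cut i => match K[i]? with
    | some (pair N L) =>
        bind (sem N) fun V => bind (sem L) fun W => Finsupp.single (splitAt K i V W) 1
    | _ => 0
  | TupAct.appl G C i => match K[i]? with
    | some (lam N) =>
        bind (sem (inst N (substTuple C K))) fun W => Finsupp.single (contractAt K G i W) 1
    | _ => 0

/-- The probability that a tuple of values performs a tuple trace. -/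
def tupProb : List TupAct → List Term → ℝ
  | [], _ => 1
  | a :: s, K => expect (tupStep K a) (tupProb s)

/-- The tuple traces that can be performed on tuples of values with the given list of types. -/
inductive TupTraceTyped {Ty : Type*} (T : TypeSystem Ty) : List Ty → List TupAct → Prop where
  | nil {S : List Ty} : TupTraceTyped T S []
  | cut {S : List Ty} {i : ℕ} {ρ σ τ : Ty} {s : List TupAct} :
      S[i]? = some ρ → T.unfold ρ = Shape.tensor σ τ →
      TupTraceTyped T (splitAt S i σ τ) s → TupTraceTyped T S (TupAct.cut i :: s)
  | appl {S : List Ty} {G : Finset ℕ} {C : Term} {i : ℕ} {ρ σ τ : Ty} {s : List TupAct} :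
      S[i]? = some ρ → T.unfold ρ = Shape.arrow σ τ →
      (∀ j ∈ G, j < S.length ∧ j ≠ i) → IsOpenValue C →
      HasType T (fun j => if j ∈ G then S[j]? else none) C σ →
      TupTraceTyped T (contractAt S G i τ) s → TupTraceTyped T S (TupAct.appl G C i :: s)

/-- The tuple distance between programs of type `θ`, defined through their value distributions. -/
def tupDist {Ty : Type*} (T : TypeSystem Ty) (θ : Ty) (M N : Term) : ENNReal :=
  ⨆ (s : List TupAct) (_ : TupTraceTyped T [θ] s),
    ENNReal.ofReal |expect (sem M) (fun V => tupProb s [V]) -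
      expect (sem N) (fun W => tupProb s [W])|

end AffineLambda

end

noncomputable section

namespace AffineLambda

open Term Env

/-! The three distances are compared in a cycle: tuple ≤ trace ≤ context ≤ tuple.

Trace ≤ context (`trDist_le_ctxDist`): a trace is a context. The action `@V` applies the hole to
`V`, the action `⊗L` eliminates it with `let`, and acceptance becomes convergence
(`TraceTyped.exists_ctx`).

Tuple ≤ trace (`tupDist_le_trDist`): every tuple trace is performed by an open term with one
variable per component, whose convergence probability is that of the trace
(`TupTraceTyped.exists_term`). On a single value, applications are already trace actions; at the
first `cut`, the whole remaining tuple trace is packed into one term `L`, and the action `⊗L` ends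
the trace.

Context ≤ tuple (`ctxDist_le_tupDist`) is the main part. A context filled with a closed program is
an open term `E` in one variable with the program substituted for it. `E` is reduced, with the
variable regarded as a computation, until it is a value, diverges, or has the variable in evaluation
position (`abs_conv_sub_le`). In the last case the program is evaluated, affinity ensures that the
variable is not used elsewhere, and what is left is to observe a distribution on one-component
tuples. The statement proved for these, `nonExpansive_conv`, concerns an arbitrary open term over a
tuple of values and an arbitrary signed measure on tuples, in particular the difference of two value
distributions. If `E` applies the component `i`, or eliminates it, then this is one action of the
tuple chain, and `E` continues as a smaller open term over the new tuple; here affinity allows the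
components used by the argument to be deleted. A choice is a convex combination, and other redexes
reduce without looking at the tuple.

All these inductions, and the existence of value distributions, rest on a size that decreases under
reduction because terms are affine (`HasType.size_inst_le`, `HasType.size_inst₂_le`). -/

namespace Term

/-! ### Calculus of renamings and substitutions. -/

theorem liftRen_comp (r r' : ℕ → ℕ) : liftRen r ∘ liftRen r' = liftRen (r ∘ r') := by
  funext n; cases n <;> rfl

theorem rename_rename (M : Term) : ∀ r r' : ℕ → ℕ,
    rename r (rename r' M) = rename (r ∘ r') M := by
  induction M <;> intro r r' <;> simp_all [rename, liftRen_comp]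

theorem up_comp_liftRen (s : ℕ → Term) (r : ℕ → ℕ) : up s ∘ liftRen r = up (s ∘ r) := by
  funext n; cases n <;> rfl

theorem subst_rename (M : Term) : ∀ (s : ℕ → Term) (r : ℕ → ℕ),
    subst s (rename r M) = subst (s ∘ r) M := by
  induction M <;> intro s r <;> simp_all [rename, subst, up_comp_liftRen]

theorem rename_comp_up (r : ℕ → ℕ) (s : ℕ → Term) :
    rename (liftRen r) ∘ up s = up (rename r ∘ s) := by
  funext n
  cases n with
  | zero => rfl
  | succ n => simp only [Function.comp, up, rename_rename]; rfl

theorem rename_subst (M : Term) : ∀ (r : ℕ → ℕ) (s : ℕ → Term),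
    rename r (subst s M) = subst (rename r ∘ s) M := by
  induction M <;> intro r s <;> simp_all [rename, subst, rename_comp_up]

theorem subst_comp_up (s t : ℕ → Term) : subst (up s) ∘ up t = up (subst s ∘ t) := by
  funext n
  cases n with
  | zero => rfl
  | succ n => simp only [Function.comp, up, subst_rename, rename_subst]; rfl

theorem subst_subst (M : Term) : ∀ s t : ℕ → Term,
    subst s (subst t M) = subst (subst s ∘ t) M := by
  induction M <;> intro s t <;> simp_all [subst, subst_comp_up]

theorem up_var : up var = var := by
  funext n; cases n <;> rfl

theorem subst_var (M : Term) : subst var M = M := by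
  induction M <;> simp_all [subst, up_var]

theorem rename_eq_subst (r : ℕ → ℕ) (M : Term) : rename r M = subst (var ∘ r) M := by
  conv_lhs => rw [← subst_var M, rename_subst]
  rfl

theorem subst_inst (s : ℕ → Term) (L V : Term) :
    subst s (inst L V) = inst (subst (up s) L) (subst s V) := by
  simp only [inst, subst_subst]
  congr 1
  funext n
  cases n with
  | zero => rfl
  | succ n =>
    simp only [Function.comp, up, scons, subst_rename]
    exact (subst_var _).symm

theorem subst_inst₂ (s : ℕ → Term) (L V W : Term) :
    subst s (inst₂ L V W) = inst₂ (subst (up (up s)) L) (subst s V) (subst s W) := by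
  simp only [inst₂, subst_subst]
  congr 1
  funext n
  rcases n with _ | _ | n
  · rfl
  · rfl
  · simp only [Function.comp, up, scons, subst_rename]
    exact (subst_var _).symm

/-! ### A size measure that affine reduction decreases. -/

/-- Lift a cost assignment under one binder. -/
def liftCost (w : ℕ → ℕ) : ℕ → ℕ
  | 0 => 0
  | n + 1 => w n

/-- The size of a term, where a variable `n` has size `w n` and only the larger branch of a choice
counts. -/
def cost : (ℕ → ℕ) → Term → ℕ
  | w, var n => w n
  | w, lam M => cost (liftCost w) M + 1
  | w, app M N => cost w M + cost w N + 1
  | w, choice M N => max (cost w M) (cost w N) + 1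
  | _, omega => 0
  | w, pair M N => cost w M + cost w N + 1
  | w, letp M N => cost w M + cost (liftCost (liftCost w)) N + 1

/-- The branches of a choice share their environment, so a variable may occur once in each; taking
the maximum there makes a substituted term count at most once. Weight 0 for variables makes any
elimination of a variable larger than the variable itself. -/
def size : Term → ℕ := cost fun _ => 0

theorem liftCost_zero : liftCost (fun _ => 0) = fun _ => 0 := by
  funext n; cases n <;> rfl

theorem size_var (n : ℕ) : size (var n) = 0 := rfl

theorem size_lam (M : Term) : size (lam M) = size M + 1 := by
  simp [size, cost, liftCost_zero]

theorem size_app (M N : Term) : size (app M N) = size M + size N + 1 := rfl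

theorem size_choice (M N : Term) : size (choice M N) = max (size M) (size N) + 1 := rfl

theorem size_pair (M N : Term) : size (pair M N) = size M + size N + 1 := rfl

theorem size_letp (M N : Term) : size (letp M N) = size M + size N + 1 := by
  simp [size, cost, liftCost_zero]

theorem liftCost_comp_liftRen (w : ℕ → ℕ) (r : ℕ → ℕ) :
    liftCost w ∘ liftRen r = liftCost (w ∘ r) := by
  funext n; cases n <;> rfl

theorem cost_rename (M : Term) : ∀ (w : ℕ → ℕ) (r : ℕ → ℕ),
    cost w (rename r M) = cost (w ∘ r) M := by
  induction M <;> intro w r <;> simp_all [rename, cost, liftCost_comp_liftRen]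

theorem size_rename (r : ℕ → ℕ) (M : Term) : size (rename r M) = size M :=
  cost_rename M _ r

theorem cost_comp_up (w : ℕ → ℕ) (s : ℕ → Term) :
    cost (liftCost w) ∘ up s = liftCost (cost w ∘ s) := by
  funext n
  cases n with
  | zero => rfl
  | succ n => simp only [Function.comp, up, cost_rename]; rfl

/-- This is the purpose of the weights: a substitution is a change of weights, so that sizes of
substituted terms can be estimated by induction on the term. -/
theorem cost_subst (M : Term) : ∀ (w : ℕ → ℕ) (s : ℕ → Term),
    cost w (subst s M) = cost (cost w ∘ s) M := by
  induction M <;> intro w s <;> simp_all [subst, cost, cost_comp_up]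

theorem liftCost_update (w : ℕ → ℕ) (k c : ℕ) :
    liftCost (Function.update w k c) = Function.update (liftCost w) (k + 1) c := by
  funext n
  cases n with
  | zero => simp [liftCost, Function.update]
  | succ n => simp [liftCost, Function.update]

end Term

/-! ### Environments and affine typing. -/

variable {Ty : Type*}

namespace Env

theorem Split.left {Γ Δ Θ : Env Ty} (h : Split Γ Δ Θ) {n : ℕ} {σ : Ty} (hn : Δ n = some σ) :
    Γ n = some σ ∧ Θ n = none := by
  rcases h n with h | h <;> simp_all

theorem Split.right {Γ Δ Θ : Env Ty} (h : Split Γ Δ Θ) {n : ℕ} {σ : Ty} (hn : Θ n = some σ) :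
    Γ n = some σ ∧ Δ n = none := by
  rcases h n with h | h <;> simp_all

theorem split_empty_right (Γ : Env Ty) : Split Γ Γ empty := fun _ => Or.inl ⟨rfl, rfl⟩

theorem split_empty_left (Γ : Env Ty) : Split Γ empty Γ := fun _ => Or.inr ⟨rfl, rfl⟩

theorem Split.of_empty {Δ Θ : Env Ty} (h : Split empty Δ Θ) : Δ = empty ∧ Θ = empty := by
  constructor <;> funext n <;> rcases h n with h | h <;> simp_all [empty]

/-- The part of `Γ` on the variables in `A`. -/
def restrict (Γ : Env Ty) (A : ℕ → Prop) : Env Ty :=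
  open Classical in fun n => if A n then Γ n else none

theorem restrict_eq_some {Γ : Env Ty} {A : ℕ → Prop} {n : ℕ} {σ : Ty} :
    Γ.restrict A n = some σ ↔ A n ∧ Γ n = some σ := by
  unfold restrict; split_ifs <;> simp_all

theorem split_restrict (Γ : Env Ty) (A : ℕ → Prop) :
    Split Γ (Γ.restrict A) (Γ.restrict fun n => ¬ A n) := by
  intro n; by_cases h : A n <;> simp [restrict, h]

end Env

variable {T : TypeSystem Ty}

namespace HasType

/-- The map `o` is a left inverse of `r` on the domain of `Γ`. It makes `r` injective there, as
affinity demands, and tells how to split `Δ`: the variable `m` goes to the side that owns `o m`. -/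
theorem rename {Γ : Env Ty} {M : Term} {τ : Ty} (h : HasType T Γ M τ) :
    ∀ {Δ : Env Ty} {r o : ℕ → ℕ}, (∀ n σ, Γ n = some σ → Δ (r n) = some σ ∧ o (r n) = n) →
      HasType T Δ (Term.rename r M) τ := by
  have lift : ∀ {Γ Δ : Env Ty} {r o : ℕ → ℕ} (ρ : Ty),
      (∀ n σ, Γ n = some σ → Δ (r n) = some σ ∧ o (r n) = n) →
      (∀ n σ, cons ρ Γ n = some σ →
        cons ρ Δ (liftRen r n) = some σ ∧ liftRen o (liftRen r n) = n) := by
    intro Γ Δ r o ρ h n σ hn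
    cases n with
    | zero => exact ⟨hn, rfl⟩
    | succ n => exact ⟨(h n σ hn).1, congrArg Nat.succ (h n σ hn).2⟩
  have split : ∀ {Γ Γ₁ Γ₂ Δ : Env Ty} {r o : ℕ → ℕ}, Split Γ Γ₁ Γ₂ →
      (∀ n σ, Γ n = some σ → Δ (r n) = some σ ∧ o (r n) = n) →
      (∀ n σ, Γ₁ n = some σ →
        Δ.restrict (fun m => Γ₁ (o m) ≠ none) (r n) = some σ ∧ o (r n) = n) ∧
      (∀ n σ, Γ₂ n = some σ →
        Δ.restrict (fun m => ¬ Γ₁ (o m) ≠ none) (r n) = some σ ∧ o (r n) = n) := by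
    intro Γ Γ₁ Γ₂ Δ r o hs h
    constructor <;> intro n σ hn
    · obtain ⟨h1, h2⟩ := h n σ (hs.left hn).1
      exact ⟨restrict_eq_some.2 ⟨by simp [h2, hn], h1⟩, h2⟩
    · obtain ⟨h1, h2⟩ := h n σ (hs.right hn).1
      exact ⟨restrict_eq_some.2 ⟨by simp [h2, (hs.right hn).2], h1⟩, h2⟩
  induction h with
  | var hn => intro Δ r o h; exact .var (h _ _ hn).1
  | lam hu _ ih => intro Δ r o h; exact .lam hu (ih (lift _ h))
  | app hs hu _ _ ih₁ ih₂ =>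
    intro Δ r o h
    exact .app (split_restrict _ _) hu (ih₁ (split hs h).1) (ih₂ (split hs h).2)
  | choice _ _ ih₁ ih₂ => intro Δ r o h; exact .choice (ih₁ h) (ih₂ h)
  | omega => intros; exact .omega
  | pair hs hu _ _ ih₁ ih₂ =>
    intro Δ r o h
    exact .pair (split_restrict _ _) hu (ih₁ (split hs h).1) (ih₂ (split hs h).2)
  | letp hs hu _ _ ih₁ ih₂ =>
    intro Δ r o h
    exact .letp (split_restrict _ _) hu (ih₁ (split hs h).1)
      (ih₂ (lift _ (lift _ (split hs h).2)))

theorem weaken {Γ Δ : Env Ty} {M : Term} {τ : Ty} (h : HasType T Γ M τ)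
    (hΔ : ∀ n σ, Γ n = some σ → Δ n = some σ) : HasType T Δ M τ := by
  have := h.rename (Δ := Δ) (r := id) (o := id) (fun n σ hn => ⟨hΔ n σ hn, rfl⟩)
  rwa [rename_eq_subst, Function.comp_id, subst_var] at this

/-- Affine substitution: the variable `m` may only be used by the substitute for `o m`. -/
theorem subst {Γ : Env Ty} {M : Term} {τ : Ty} (h : HasType T Γ M τ) :
    ∀ {Δ : Env Ty} {s : ℕ → Term} {o : ℕ → ℕ},
      (∀ n σ, Γ n = some σ → HasType T (Δ.restrict fun m => o m = n) (s n) σ) →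
      HasType T Δ (Term.subst s M) τ := by
  have lift : ∀ {Γ Δ : Env Ty} {s : ℕ → Term} {o : ℕ → ℕ} (ρ : Ty),
      (∀ n σ, Γ n = some σ → HasType T (Δ.restrict fun m => o m = n) (s n) σ) →
      (∀ n σ, cons ρ Γ n = some σ →
        HasType T ((cons ρ Δ).restrict fun m => liftRen o m = n) (up s n) σ) := by
    intro Γ Δ s o ρ h n σ hn
    cases n with
    | zero => exact .var (restrict_eq_some.2 ⟨rfl, hn⟩)
    | succ n =>
      refine (h n σ hn).rename (o := Nat.pred) fun m γ hm => ⟨?_, rfl⟩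
      obtain ⟨h1, h2⟩ := restrict_eq_some.1 hm
      exact restrict_eq_some.2 ⟨congrArg Nat.succ h1, h2⟩
  -- A split of `Γ` induces one of `Δ`, since every variable of `Δ` has a single owner under `o`.
  have split : ∀ {Γ Γ₁ Γ₂ Δ : Env Ty} {s : ℕ → Term} {o : ℕ → ℕ}, Split Γ Γ₁ Γ₂ →
      (∀ n σ, Γ n = some σ → HasType T (Δ.restrict fun m => o m = n) (s n) σ) →
      (∀ n σ, Γ₁ n = some σ →
        HasType T ((Δ.restrict fun m => Γ₁ (o m) ≠ none).restrict fun m => o m = n) (s n) σ) ∧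
      (∀ n σ, Γ₂ n = some σ →
        HasType T ((Δ.restrict fun m => ¬ Γ₁ (o m) ≠ none).restrict fun m => o m = n)
          (s n) σ) := by
    intro Γ Γ₁ Γ₂ Δ s o hs h
    constructor <;> intro n σ hn
    · refine (h n σ (hs.left hn).1).weaken fun m γ hm => ?_
      obtain ⟨h1, h2⟩ := restrict_eq_some.1 hm
      exact restrict_eq_some.2 ⟨h1, restrict_eq_some.2 ⟨by simp [h1, hn], h2⟩⟩
    · refine (h n σ (hs.right hn).1).weaken fun m γ hm => ?_
      obtain ⟨h1, h2⟩ := restrict_eq_some.1 hm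
      exact restrict_eq_some.2 ⟨h1, restrict_eq_some.2 ⟨by simp [h1, (hs.right hn).2], h2⟩⟩
  induction h with
  | var hn =>
    intro Δ s o h
    exact (h _ _ hn).weaken fun m γ hm => (restrict_eq_some.1 hm).2
  | lam hu _ ih => intro Δ s o h; exact .lam hu (ih (lift _ h))
  | app hs hu _ _ ih₁ ih₂ =>
    intro Δ s o h
    exact .app (split_restrict _ _) hu (ih₁ (split hs h).1) (ih₂ (split hs h).2)
  | choice _ _ ih₁ ih₂ => intro Δ s o h; exact .choice (ih₁ h) (ih₂ h)
  | omega => intros; exact .omega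
  | pair hs hu _ _ ih₁ ih₂ =>
    intro Δ s o h
    exact .pair (split_restrict _ _) hu (ih₁ (split hs h).1) (ih₂ (split hs h).2)
  | letp hs hu _ _ ih₁ ih₂ =>
    intro Δ s o h
    exact .letp (split_restrict _ _) hu (ih₁ (split hs h).1)
      (ih₂ (lift _ (lift _ (split hs h).2)))

theorem subst_congr {Γ : Env Ty} {M : Term} {τ : Ty} (h : HasType T Γ M τ) :
    ∀ {s t : ℕ → Term}, (∀ n, Γ n ≠ none → s n = t n) → Term.subst s M = Term.subst t M := by
  have lift : ∀ {Γ : Env Ty} {s t : ℕ → Term} (ρ : Ty), (∀ n, Γ n ≠ none → s n = t n) →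
      ∀ n, cons ρ Γ n ≠ none → up s n = up t n := by
    intro Γ s t ρ h n hn
    cases n with
    | zero => rfl
    | succ n => exact congrArg _ (h n hn)
  have left : ∀ {Γ Δ Θ : Env Ty}, Split Γ Δ Θ → ∀ n, Δ n ≠ none → Γ n ≠ none := by
    intro Γ Δ Θ hs n hn
    rcases hs n with h | h <;> simp_all
  have right : ∀ {Γ Δ Θ : Env Ty}, Split Γ Δ Θ → ∀ n, Θ n ≠ none → Γ n ≠ none := by
    intro Γ Δ Θ hs n hn
    rcases hs n with h | h <;> simp_all
  induction h with
  | var hn => intro s t h; exact h _ (by simp [hn])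
  | lam hu _ ih => intro s t h; exact congrArg Term.lam (ih (lift _ h))
  | app hs hu _ _ ih₁ ih₂ =>
    intro s t h
    exact congrArg₂ Term.app (ih₁ fun n hn => h n (left hs n hn))
      (ih₂ fun n hn => h n (right hs n hn))
  | choice _ _ ih₁ ih₂ => intro s t h; exact congrArg₂ Term.choice (ih₁ h) (ih₂ h)
  | omega => intros; rfl
  | pair hs hu _ _ ih₁ ih₂ =>
    intro s t h
    exact congrArg₂ Term.pair (ih₁ fun n hn => h n (left hs n hn))
      (ih₂ fun n hn => h n (right hs n hn))
  | letp hs hu _ _ ih₁ ih₂ =>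
    intro s t h
    exact congrArg₂ Term.letp (ih₁ fun n hn => h n (left hs n hn))
      (ih₂ (lift _ (lift _ fun n hn => h n (right hs n hn))))

/-- In a split environment the variable `k` belongs to one part only, so the increase `c` is paid
once. The second clause says that the other part does not change; it is what makes the induction go
through. -/
theorem cost_update_le {Γ : Env Ty} {M : Term} {τ : Ty} (h : HasType T Γ M τ) :
    ∀ (w : ℕ → ℕ) (k c : ℕ), cost (Function.update w k c) M ≤ cost w M + c ∧
      (Γ k = none → cost (Function.update w k c) M = cost w M) := by
  induction h with
  | @var Γ n τ hn =>
    intro w k c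
    by_cases h : n = k
    · subst h; simp [cost, hn]
    · simp [cost, h]
  | lam hu _ ih =>
    intro w k c
    simp only [cost, liftCost_update]
    have := ih (liftCost w) (k + 1) c
    simp only [cons] at this
    exact ⟨by have := this.1; omega, fun h => by have := this.2 h; omega⟩
  | app hs hu _ _ ih₁ ih₂ =>
    intro w k c
    simp only [cost]
    have h₁ := ih₁ w k c
    have h₂ := ih₂ w k c
    rcases hs k with ⟨e, h⟩ | ⟨h, e⟩
    · rw [e] at h₁; grind
    · rw [e] at h₂; grind
  | choice _ _ ih₁ ih₂ =>
    intro w k c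
    simp only [cost]
    have h₁ := ih₁ w k c
    have h₂ := ih₂ w k c
    grind
  | omega => intros; simp [cost]
  | pair hs hu _ _ ih₁ ih₂ =>
    intro w k c
    simp only [cost]
    have h₁ := ih₁ w k c
    have h₂ := ih₂ w k c
    rcases hs k with ⟨e, h⟩ | ⟨h, e⟩
    · rw [e] at h₁; grind
    · rw [e] at h₂; grind
  | letp hs hu _ _ ih₁ ih₂ =>
    intro w k c
    simp only [cost, liftCost_update]
    have h₁ := ih₁ w k c
    have h₂ := ih₂ (liftCost (liftCost w)) (k + 1 + 1) c
    simp only [cons] at h₂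
    rcases hs k with ⟨e, h⟩ | ⟨h, e⟩
    · rw [e] at h₁; grind
    · rw [e] at h₂; grind

/-- The termination measure: as an abstraction counts one more than its body, a β-step strictly
lowers the size. -/
theorem size_inst_le {Γ : Env Ty} {L : Term} {τ : Ty} (h : HasType T Γ L τ) (V : Term) :
    size (inst L V) ≤ size L + size V := by
  have e : cost (fun _ => 0) ∘ scons V Term.var = Function.update (fun _ => 0) 0 (size V) := by
    funext n
    cases n <;> simp [scons, Function.update, size, cost]
  have := (h.cost_update_le (fun _ => 0) 0 (size V)).1
  rwa [← e, ← cost_subst] at this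

theorem size_inst₂_le {Γ : Env Ty} {L : Term} {τ : Ty} (h : HasType T Γ L τ) (V W : Term) :
    size (inst₂ L V W) ≤ size L + size V + size W := by
  have e : cost (fun _ => 0) ∘ scons V (scons W Term.var) =
      Function.update (Function.update (fun _ => 0) 0 (size V)) 1 (size W) := by
    funext n
    rcases n with _ | _ | n <;> simp [scons, Function.update, size, cost]
  have h₁ := (h.cost_update_le (fun _ => 0) 0 (size V)).1
  have h₂ := (h.cost_update_le (Function.update (fun _ => 0) 0 (size V)) 1 (size W)).1
  rw [← e, ← cost_subst] at h₂
  exact h₂.trans (Nat.add_le_add_right h₁ _)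

theorem inst {Γ Δ Θ : Env Ty} {L V : Term} {σ τ : Ty} (hs : Split Γ Δ Θ)
    (hL : HasType T (cons σ Δ) L τ) (hV : HasType T Θ V σ) : HasType T Γ (Term.inst L V) τ := by
  classical
  -- The variables of `Θ` are owned by the substitute `V` of index 0; any other variable `m` is the
  -- substitute of index `m + 1`.
  refine hL.subst (o := fun m => if Θ m = none then m + 1 else 0) fun n γ hn => ?_
  cases n with
  | zero =>
    cases hn
    exact hV.weaken fun m δ hm => restrict_eq_some.2 ⟨by simp [hm], (hs.right hm).1⟩
  | succ n =>
    exact .var (restrict_eq_some.2 ⟨by simp [(hs.left hn).2], (hs.left hn).1⟩)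

theorem inst₂ {Γ Δ Θ Θ₁ Θ₂ : Env Ty} {L V W : Term} {σ₁ σ₂ τ : Ty} (hs : Split Γ Θ Δ)
    (hs' : Split Θ Θ₁ Θ₂) (hL : HasType T (cons σ₁ (cons σ₂ Δ)) L τ) (hV : HasType T Θ₁ V σ₁)
    (hW : HasType T Θ₂ W σ₂) : HasType T Γ (Term.inst₂ L V W) τ := by
  classical
  -- Owner 0 is `V`, owner 1 is `W`, and variables outside `Θ` stand for themselves, shifted past
  -- the two binders.
  refine hL.subst (o := fun m => if Θ m = none then m + 2 else if Θ₁ m = none then 1 else 0)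
    fun n γ hn => ?_
  rcases n with _ | _ | n
  · cases hn
    exact hV.weaken fun m δ hm =>
      restrict_eq_some.2 ⟨by simp [hm, (hs'.left hm).1], (hs.left (hs'.left hm).1).1⟩
  · cases hn
    exact hW.weaken fun m δ hm =>
      restrict_eq_some.2 ⟨by simp [(hs'.right hm).2, (hs'.right hm).1],
        (hs.left (hs'.right hm).1).1⟩
  · exact .var (restrict_eq_some.2 ⟨by simp [(hs.right hn).2], (hs.right hn).1⟩)

end HasType

theorem IsProgram.hasType {σ : Ty} {M : Term} (h : IsProgram T σ M) (Γ : Env Ty) :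
    HasType T Γ M σ := h.weaken fun _ _ hn => nomatch hn

theorem IsProgram.subst_eq {σ : Ty} {M : Term} (h : IsProgram T σ M) (s : ℕ → Term) :
    Term.subst s M = M :=
  (h.subst_congr fun _ hn => absurd rfl hn).trans (subst_var M)

theorem IsProgram.rename_eq {σ : Ty} {M : Term} (h : IsProgram T σ M) (r : ℕ → ℕ) :
    Term.rename r M = M := by
  rw [rename_eq_subst, h.subst_eq]

theorem HasType.inst_program {L V : Term} {σ τ : Ty}
    (hL : HasType T (cons σ Env.empty) L τ) (hV : IsProgram T σ V) :
    IsProgram T τ (Term.inst L V) :=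
  HasType.inst (split_empty_left _) hL hV

theorem HasType.inst₂_program {L V W : Term} {σ₁ σ₂ τ : Ty}
    (hL : HasType T (cons σ₁ (cons σ₂ Env.empty)) L τ) (hV : IsProgram T σ₁ V)
    (hW : IsProgram T σ₂ W) : IsProgram T τ (Term.inst₂ L V W) :=
  HasType.inst₂ (split_empty_left _) (split_empty_left _) hL hV hW

/-! ### Finite, possibly signed, distributions. -/

section Distributions

variable {α β γ : Type*}

theorem bind_eq_linearCombination (D : α →₀ ℝ) (f : α → β →₀ ℝ) :
    bind D f = Finsupp.linearCombination ℝ f D := rfl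

theorem expect_eq_linearCombination (D : α →₀ ℝ) (f : α → ℝ) :
    expect D f = Finsupp.linearCombination ℝ f D := rfl

theorem bind_congr {D : α →₀ ℝ} {f g : α → β →₀ ℝ} (h : ∀ a ∈ D.support, f a = g a) :
    bind D f = bind D g :=
  Finset.sum_congr rfl fun a ha => by simp only [h a ha]

theorem expect_congr {D : α →₀ ℝ} {f g : α → ℝ} (h : ∀ a ∈ D.support, f a = g a) :
    expect D f = expect D g :=
  Finset.sum_congr rfl fun a ha => by simp only [h a ha]

@[simp] theorem bind_single (a : α) (f : α → β →₀ ℝ) : bind (Finsupp.single a 1) f = f a := by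
  simp [bind_eq_linearCombination]

@[simp] theorem expect_single (a : α) (f : α → ℝ) : expect (Finsupp.single a 1) f = f a := by
  simp [expect_eq_linearCombination]

@[simp] theorem expect_zero (f : α → ℝ) : expect 0 f = 0 := rfl

theorem expect_half (D E : α →₀ ℝ) (f : α → ℝ) :
    expect ((1 / 2 : ℝ) • D + (1 / 2 : ℝ) • E) f =
      1 / 2 * expect D f + 1 / 2 * expect E f := by
  simp only [expect_eq_linearCombination, map_add, map_smul, smul_eq_mul]

theorem expect_sub (D E : α →₀ ℝ) (f : α → ℝ) :
    expect (D - E) f = expect D f - expect E f := by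
  simp only [expect_eq_linearCombination, map_sub]

theorem expect_mul_left (D : α →₀ ℝ) (c : ℝ) (f : α → ℝ) :
    expect D (fun a => c * f a) = c * expect D f := by
  simp only [expect, Finsupp.sum, Finset.mul_sum]
  exact Finset.sum_congr rfl fun a _ => by ring

theorem expect_add (D : α →₀ ℝ) (f g : α → ℝ) :
    expect D (fun a => f a + g a) = expect D f + expect D g := by
  simp only [expect, Finsupp.sum, mul_add, Finset.sum_add_distrib]

theorem expect_const_zero (D : α →₀ ℝ) : expect D (fun _ => 0) = 0 := by
  simp [expect]

theorem bind_bind (D : α →₀ ℝ) (f : α → β →₀ ℝ) (g : β → γ →₀ ℝ) :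
    bind (bind D f) g = bind D fun a => bind (f a) g := by
  rw [bind_eq_linearCombination (bind D f), bind, Finsupp.sum, map_sum]
  exact Finset.sum_congr rfl fun a _ => map_smul _ _ _

theorem expect_bind (D : α →₀ ℝ) (f : α → β →₀ ℝ) (g : β → ℝ) :
    expect (bind D f) g = expect D fun a => expect (f a) g := by
  rw [expect_eq_linearCombination (bind D f), bind, Finsupp.sum, map_sum]
  exact Finset.sum_congr rfl fun a _ => map_smul _ _ _

theorem bind_comm (D : α →₀ ℝ) (E : β →₀ ℝ) (f : α → β → γ →₀ ℝ) :
    (bind D fun a => bind E (f a)) = bind E fun b => bind D fun a => f a b := by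
  simp only [bind, Finsupp.sum, Finset.smul_sum]
  rw [Finset.sum_comm]
  exact Finset.sum_congr rfl fun b _ => Finset.sum_congr rfl fun a _ => smul_comm _ _ _

theorem exists_mem_support_of_mem_bind {D : α →₀ ℝ} {f : α → β →₀ ℝ} {b : β}
    (h : b ∈ (bind D f).support) : ∃ a ∈ D.support, b ∈ (f a).support := by
  classical
  obtain ⟨a, ha, hb⟩ := Finset.mem_biUnion.1 (Finsupp.support_sum h)
  exact ⟨a, ha, Finsupp.support_smul hb⟩

theorem weight_eq_expect (D : α →₀ ℝ) : weight D = expect D fun _ => 1 := by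
  simp [weight, expect]

end Distributions

/-! ### Evaluation of programs: uniqueness, existence, and equations for `sem`. -/

theorem BigStep.unique {M : Term} {D : Term →₀ ℝ} (h : BigStep M D) :
    ∀ {E : Term →₀ ℝ}, BigStep M E → D = E := by
  induction h with
  | omega => intro E h; cases h with
    | omega => rfl
    | value hV => exact hV.elim
  | value hV => intro E h; cases h with
    | value _ => rfl
    | _ => exact hV.elim
  | choice _ _ ih₁ ih₂ => intro E h; cases h with
    | value hV => exact hV.elim
    | choice h₁ h₂ => rw [ih₁ h₁, ih₂ h₂]
  | app _ _ _ ih₁ ih₂ ih₃ => intro E h; cases h with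
    | value hV => exact hV.elim
    | app h₁ h₂ h₃ =>
      cases ih₁ h₁
      cases ih₂ h₂
      -- The families in the two derivations need to agree only on the supports, where the premises
      -- of the rule speak about them.
      refine bind_congr fun U hU => ?_
      cases U with
      | lam L => exact bind_congr fun V hV => ih₃ L V hU hV (h₃ L V hU hV)
      | _ => rfl
  | letp _ _ _ _ ih₁ ih₂ ih₃ ih₄ => intro E h; cases h with
    | value hV => exact hV.elim
    | letp h₁ h₂ h₃ h₄ =>
      cases ih₁ h₁
      refine bind_congr fun U hU => ?_
      cases U with
      | pair L K =>
        have e₁ := ih₂ L K hU (h₂ L K hU)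
        have e₂ := ih₃ L K hU (h₃ L K hU)
        simp only [← e₁, ← e₂]
        exact bind_congr fun V hV => bind_congr fun W hW =>
          ih₄ L K V W hU hV hW (h₄ L K V W hU (e₁ ▸ hV) (e₂ ▸ hW))
      | _ => rfl

theorem BigStep.sem_eq {M : Term} {D : Term →₀ ℝ} (h : BigStep M D) : sem M = D := by
  have hex : ∃ D, BigStep M D := ⟨D, h⟩
  rw [sem, dif_pos hex]
  exact hex.choose_spec.unique h

theorem HasType.lam_inv {Γ : Env Ty} {L : Term} {ρ σ τ : Ty} (h : HasType T Γ (Term.lam L) ρ)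
    (hu : T.unfold ρ = .arrow σ τ) : HasType T (cons σ Γ) L τ := by
  cases h with
  | lam hu' h =>
    rw [hu] at hu'
    cases hu'
    exact h

theorem HasType.pair_inv {L K : Term} {ρ σ τ : Ty} (h : IsProgram T ρ (Term.pair L K))
    (hu : T.unfold ρ = .tensor σ τ) : IsProgram T σ L ∧ IsProgram T τ K := by
  cases h with
  | pair hs hu' h₁ h₂ =>
    rw [hu] at hu'
    cases hu'
    obtain ⟨rfl, rfl⟩ := hs.of_empty
    exact ⟨h₁, h₂⟩

/-- Every program has a value distribution, supported on smaller values of the same type. -/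
theorem IsProgram.exists_bigStep (n : ℕ) : ∀ {σ : Ty} {M : Term}, IsProgram T σ M → size M ≤ n →
    ∃ D, BigStep M D ∧ ∀ V ∈ D.support, IsValue V ∧ IsProgram T σ V ∧ size V ≤ size M := by
  induction n using Nat.strong_induction_on with
  | _ n ih =>
  intro σ M hM hn
  have value : IsValue M →
      ∃ D, BigStep M D ∧ ∀ V ∈ D.support, IsValue V ∧ IsProgram T σ V ∧ size V ≤ size M := by
    intro hV
    refine ⟨_, .value hV, fun V h => ?_⟩
    obtain rfl : V = M := by simpa using (Finsupp.support_single_subset h)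
    exact ⟨hV, hM, le_rfl⟩
  have cases_hM := hM
  cases cases_hM with
  | var h => exact nomatch h
  | lam => exact value trivial
  | pair => exact value trivial
  | omega => exact ⟨0, .omega, fun V h => by simp at h⟩
  | @choice _ A B _ hA hB =>
    rw [size_choice] at hn ⊢
    obtain ⟨D, hD, hD'⟩ := ih (size A) (by omega) hA le_rfl
    obtain ⟨E, hE, hE'⟩ := ih (size B) (by omega) hB le_rfl
    refine ⟨_, .choice hD hE, fun V hV => ?_⟩
    classical
    rcases Finset.mem_union.1 (Finsupp.support_add hV) with h | h
    · obtain ⟨h₁, h₂, h₃⟩ := hD' V (Finsupp.support_smul h)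
      exact ⟨h₁, h₂, by omega⟩
    · obtain ⟨h₁, h₂, h₃⟩ := hE' V (Finsupp.support_smul h)
      exact ⟨h₁, h₂, by omega⟩
  | @app _ _ _ A B ρ γ _ hs hu hA hB =>
    rw [size_app] at hn ⊢
    obtain ⟨rfl, rfl⟩ := hs.of_empty
    obtain ⟨D, hD, hD'⟩ := ih (size A) (by omega) hA le_rfl
    obtain ⟨E, hE, hE'⟩ := ih (size B) (by omega) hB le_rfl
    -- The value 0 off the supports allows `choose` to produce the total family that the rule
    -- requires.
    have key : ∀ L V, ∃ F, lam L ∈ D.support → V ∈ E.support → BigStep (Term.inst L V) F ∧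
        ∀ W ∈ F.support, IsValue W ∧ IsProgram T σ W ∧ size W ≤ size A + size B + 1 := by
      intro L V
      by_cases h : lam L ∈ D.support ∧ V ∈ E.support
      · obtain ⟨-, h₁, h₂⟩ := hD' _ h.1
        obtain ⟨-, h₃, h₄⟩ := hE' _ h.2
        have hL := HasType.lam_inv h₁ hu
        have hsz := hL.size_inst_le V
        rw [size_lam] at h₂
        obtain ⟨F, hF, hF'⟩ := ih (size (Term.inst L V)) (by omega) (hL.inst_program h₃) le_rfl
        refine ⟨F, fun _ _ => ⟨hF, fun W hW => ?_⟩⟩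
        obtain ⟨k₁, k₂, k₃⟩ := hF' W hW
        exact ⟨k₁, k₂, by omega⟩
      · exact ⟨0, fun h₁ h₂ => absurd ⟨h₁, h₂⟩ h⟩
    choose F hF using key
    refine ⟨_, .app hD hE fun L V hL hV => (hF L V hL hV).1, fun W hW => ?_⟩
    obtain ⟨U, hU, hW⟩ := exists_mem_support_of_mem_bind hW
    cases U with
    | lam L =>
      obtain ⟨V, hV, hW⟩ := exists_mem_support_of_mem_bind hW
      exact (hF L V hU hV).2 W hW
    | _ => simp at hW
  | @letp _ _ _ A B ρ σ₁ σ₂ _ hs hu hA hB =>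
    rw [size_letp] at hn ⊢
    obtain ⟨rfl, rfl⟩ := hs.of_empty
    obtain ⟨D, hD, hD'⟩ := ih (size A) (by omega) hA le_rfl
    -- The distribution of `L` must not depend on the component `K` paired with it, whence the order
    -- of the quantifiers.
    have key₁ : ∀ L, ∃ F, ∀ K, pair L K ∈ D.support → BigStep L F ∧
        ∀ W ∈ F.support, IsProgram T σ₁ W ∧ size W ≤ size L := by
      intro L
      by_cases h : ∃ K, pair L K ∈ D.support
      · obtain ⟨K, hK⟩ := h
        obtain ⟨-, h₁, h₂⟩ := hD' _ hK
        rw [size_pair] at h₂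
        obtain ⟨F, hF, hF'⟩ := ih (size L) (by omega) (HasType.pair_inv h₁ hu).1 le_rfl
        exact ⟨F, fun _ _ => ⟨hF, fun W hW => (hF' W hW).2⟩⟩
      · exact ⟨0, fun K hK => absurd ⟨K, hK⟩ h⟩
    have key₂ : ∀ K, ∃ F, ∀ L, pair L K ∈ D.support → BigStep K F ∧
        ∀ W ∈ F.support, IsProgram T σ₂ W ∧ size W ≤ size K := by
      intro K
      by_cases h : ∃ L, pair L K ∈ D.support
      · obtain ⟨L, hL⟩ := h
        obtain ⟨-, h₁, h₂⟩ := hD' _ hL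
        rw [size_pair] at h₂
        obtain ⟨F, hF, hF'⟩ := ih (size K) (by omega) (HasType.pair_inv h₁ hu).2 le_rfl
        exact ⟨F, fun _ _ => ⟨hF, fun W hW => (hF' W hW).2⟩⟩
      · exact ⟨0, fun K hK => absurd ⟨K, hK⟩ h⟩
    choose F hF using key₁
    choose G hG using key₂
    have key₃ : ∀ V W, ∃ E, ∀ L K, pair L K ∈ D.support → V ∈ (F L).support →
        W ∈ (G K).support → BigStep (Term.inst₂ B V W) E ∧
        ∀ W ∈ E.support, IsValue W ∧ IsProgram T σ W ∧ size W ≤ size A + size B + 1 := by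
      intro V W
      by_cases h : ∃ L K, pair L K ∈ D.support ∧ V ∈ (F L).support ∧ W ∈ (G K).support
      · obtain ⟨L, K, hLK, hV, hW⟩ := h
        obtain ⟨-, h₁, h₂⟩ := hD' _ hLK
        rw [size_pair] at h₂
        obtain ⟨h₃, h₄⟩ := (hF L K hLK).2 V hV
        obtain ⟨h₅, h₆⟩ := (hG K L hLK).2 W hW
        have hsz := hB.size_inst₂_le V W
        obtain ⟨E, hE, hE'⟩ := ih (size (Term.inst₂ B V W)) (by omega)
          (hB.inst₂_program h₃ h₅) le_rfl
        refine ⟨E, fun _ _ _ _ _ => ⟨hE, fun W hW => ?_⟩⟩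
        obtain ⟨k₁, k₂, k₃⟩ := hE' W hW
        exact ⟨k₁, k₂, by omega⟩
      · exact ⟨0, fun L K h₁ h₂ h₃ => absurd ⟨L, K, h₁, h₂, h₃⟩ h⟩
    choose E hE using key₃
    refine ⟨_, .letp hD (fun L K h => (hF L K h).1) (fun L K h => (hG K L h).1)
      fun L K V W h hV hW => (hE V W L K h hV hW).1, fun Z hZ => ?_⟩
    obtain ⟨U, hU, hZ⟩ := exists_mem_support_of_mem_bind hZ
    cases U with
    | pair L K =>
      obtain ⟨V, hV, hZ⟩ := exists_mem_support_of_mem_bind hZ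
      obtain ⟨W, hW, hZ⟩ := exists_mem_support_of_mem_bind hZ
      exact (hE V W L K hU hV hW).2 Z hZ
    | _ => simp at hZ

theorem IsProgram.bigStep_sem {σ : Ty} {M : Term} (h : IsProgram T σ M) : BigStep M (sem M) := by
  obtain ⟨D, hD, -⟩ := IsProgram.exists_bigStep _ h le_rfl
  rwa [hD.sem_eq]

theorem IsProgram.of_mem_sem {σ : Ty} {M V : Term} (h : IsProgram T σ M)
    (hV : V ∈ (sem M).support) : IsValue V ∧ IsProgram T σ V := by
  obtain ⟨D, hD, hD'⟩ := IsProgram.exists_bigStep _ h le_rfl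
  rw [hD.sem_eq] at hV
  exact ⟨(hD' V hV).1, (hD' V hV).2.1⟩

/-- The value distribution of the application of a value to a value. -/
def appSem : Term → Term → (Term →₀ ℝ)
  | lam L, V => sem (inst L V)
  | _, _ => 0

/-- The value distribution of the elimination of a value. -/
def letSem : Term → Term → (Term →₀ ℝ)
  | pair L K, N => bind (sem L) fun V => bind (sem K) fun W => sem (inst₂ N V W)
  | _, _ => 0

theorem sem_value {V : Term} (h : IsValue V) : sem V = Finsupp.single V 1 :=
  (BigStep.value h).sem_eq

theorem sem_omega : sem omega = 0 := BigStep.omega.sem_eq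

theorem sem_choice {M N : Term} {σ : Ty} (h : IsProgram T σ (choice M N)) :
    sem (choice M N) = (1 / 2 : ℝ) • sem M + (1 / 2 : ℝ) • sem N := by
  cases h with
  | choice hM hN =>
    exact (BigStep.choice (IsProgram.bigStep_sem hM) (IsProgram.bigStep_sem hN)).sem_eq

theorem sem_app {M N : Term} {σ : Ty} (h : IsProgram T σ (app M N)) :
    sem (app M N) = bind (sem M) fun U => bind (sem N) fun V => appSem U V := by
  cases h with
  | app hs hu hM hN =>
    obtain ⟨rfl, rfl⟩ := hs.of_empty
    rw [(BigStep.app (IsProgram.bigStep_sem hM) (IsProgram.bigStep_sem hN)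
      (F := fun L V => sem (inst L V)) fun L V hL hV => IsProgram.bigStep_sem
        ((HasType.lam_inv (IsProgram.of_mem_sem hM hL).2 hu).inst_program
          (IsProgram.of_mem_sem hN hV).2)).sem_eq]
    refine bind_congr fun U _ => ?_
    cases U with
    | lam L => rfl
    | _ => simp [bind, appSem]

theorem sem_letp {M N : Term} {σ : Ty} (h : IsProgram T σ (letp M N)) :
    sem (letp M N) = bind (sem M) fun U => letSem U N := by
  cases h with
  | letp hs hu hM hN =>
    obtain ⟨rfl, rfl⟩ := hs.of_empty
    have hp : ∀ L K, pair L K ∈ (sem M).support → _ := fun L K h =>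
      HasType.pair_inv (IsProgram.of_mem_sem hM h).2 hu
    rw [(BigStep.letp (IsProgram.bigStep_sem hM) (F := sem) (G := sem)
      (E := fun V W => sem (inst₂ N V W)) (fun L K h => IsProgram.bigStep_sem (hp L K h).1)
      (fun L K h => IsProgram.bigStep_sem (hp L K h).2) fun L K V W h hV hW =>
        IsProgram.bigStep_sem (hN.inst₂_program (IsProgram.of_mem_sem (hp L K h).1 hV).2
          (IsProgram.of_mem_sem (hp L K h).2 hW).2)).sem_eq]
    refine bind_congr fun U _ => ?_
    cases U <;> rfl

theorem sem_app_value {V W : Term} {σ : Ty} (hV : IsValue V) (hW : IsValue W)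
    (h : IsProgram T σ (app V W)) : sem (app V W) = appSem V W := by
  rw [sem_app h, sem_value hV, sem_value hW, bind_single, bind_single]

theorem sem_letp_value {V N : Term} {σ : Ty} (hV : IsValue V)
    (h : IsProgram T σ (letp V N)) : sem (letp V N) = letSem V N := by
  rw [sem_letp h, sem_value hV, bind_single]

theorem conv_value {V : Term} (h : IsValue V) : conv V = 1 := by
  rw [conv, sem_value h, weight_eq_expect, expect_single]

/-! ### Evaluation contexts -/

/-- Call-by-value evaluation contexts. -/
inductive EvalCtx : Type where
  | hole : EvalCtx
  | appL : EvalCtx → Term → EvalCtx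
  | appR : Term → EvalCtx → EvalCtx
  | letL : EvalCtx → Term → EvalCtx
  | letPairL : EvalCtx → Term → Term → EvalCtx
  | letPairR : Term → EvalCtx → Term → EvalCtx

namespace Env

theorem Split.symm {Γ Δ Θ : Env Ty} (h : Split Γ Δ Θ) : Split Γ Θ Δ :=
  fun n => (h n).symm.imp And.symm And.symm

/-- Splitting is associative: `Θ'` is what remains of `Γ` outside `Δ`. -/
theorem Split.assoc {Γ Γ₁ Γ₂ Δ Θ : Env Ty} (h : Split Γ Γ₁ Γ₂) (h' : Split Γ₁ Δ Θ) :
    ∃ Θ', Split Γ Δ Θ' ∧ Split Θ' Θ Γ₂ := by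
  classical
  refine ⟨fun n => if Δ n = none then Γ n else none, fun n => ?_, fun n => ?_⟩
  · rcases h n with h | h <;> rcases h' n with h' | h' <;> grind
  · rcases h n with h | h <;> rcases h' n with h' | h' <;> grind

theorem Split.assoc_symm {Γ Δ Θ Θ₁ Θ₂ : Env Ty} (h : Split Γ Δ Θ) (h' : Split Θ Θ₁ Θ₂) :
    ∃ Δ', Split Γ Δ' Θ₂ ∧ Split Δ' Δ Θ₁ := by
  obtain ⟨Δ', h₁, h₂⟩ := h.symm.assoc h'.symm
  exact ⟨Δ', h₁.symm, h₂.symm⟩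

theorem Split.ne_none_left {Γ Δ Θ : Env Ty} (h : Split Γ Δ Θ) {n : ℕ} (hn : Δ n ≠ none) :
    Γ n ≠ none := by
  rcases h n with h | h <;> simp_all

theorem Split.ne_none_right {Γ Δ Θ : Env Ty} (h : Split Γ Δ Θ) {n : ℕ} (hn : Θ n ≠ none) :
    Γ n ≠ none := h.symm.ne_none_left hn

end Env

theorem eq_up_of_cons {Γ : Env Ty} {s t : ℕ → Term} (σ : Ty) (h : ∀ n, Γ n ≠ none → s n = t n) :
    ∀ n, cons σ Γ n ≠ none → up s n = up t n := by
  intro n hn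
  cases n with
  | zero => rfl
  | succ n => exact congrArg _ (h n hn)

namespace EvalCtx

/-- A pair is a value with unevaluated components, which are evaluated only when the pair is
eliminated; so the hole can be inside a pair only directly under a `let`. The other parts of a frame
need not be values, because the order in which independent parts are evaluated does not affect the
distribution. -/
def plug : EvalCtx → Term → Term
  | hole, M => M
  | appL e N, M => app (e.plug M) N
  | appR N e, M => app N (e.plug M)
  | letL e N, M => letp (e.plug M) N
  | letPairL e K N, M => letp (pair (e.plug M) K) N
  | letPairR L e N, M => letp (pair L (e.plug M)) N

def subst (s : ℕ → Term) : EvalCtx → EvalCtx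
  | hole => hole
  | appL e N => appL (e.subst s) (Term.subst s N)
  | appR N e => appR (Term.subst s N) (e.subst s)
  | letL e N => letL (e.subst s) (Term.subst (up (up s)) N)
  | letPairL e K N => letPairL (e.subst s) (Term.subst s K) (Term.subst (up (up s)) N)
  | letPairR L e N => letPairR (Term.subst s L) (e.subst s) (Term.subst (up (up s)) N)

theorem subst_plug (s : ℕ → Term) (e : EvalCtx) (M : Term) :
    Term.subst s (e.plug M) = (e.subst s).plug (Term.subst s M) := by
  induction e <;> simp_all [plug, subst, Term.subst]

theorem size_plug_lt (e : EvalCtx) {M N : Term} (h : size M < size N) :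
    size (e.plug M) < size (e.plug N) := by
  induction e <;> simp only [plug, size_app, size_letp, size_pair] <;> omega

/-- The context of a typed decomposition has an environment of its own, which determines the
effect of substitutions, and the plugged term can be replaced by another term of the same type. -/
theorem plug_inv (e : EvalCtx) : ∀ {Γ : Env Ty} {M : Term} {τ : Ty},
    HasType T Γ (e.plug M) τ → ∃ Δ Θ σ, Split Γ Δ Θ ∧ HasType T Δ M σ ∧
      (∀ s t : ℕ → Term, (∀ n, Θ n ≠ none → s n = t n) → e.subst s = e.subst t) ∧
      ∀ Γ' Δ' N, Split Γ' Δ' Θ → HasType T Δ' N σ → HasType T Γ' (e.plug N) τ := by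
  induction e with
  | hole =>
    intro Γ M τ h
    refine ⟨Γ, Env.empty, τ, split_empty_right _, h, fun _ _ _ => rfl, fun Γ' Δ' N hs hN => ?_⟩
    exact hN.weaken fun n σ hn => (hs.left hn).1
  | appL e N ih =>
    intro Γ M τ h
    cases h with
    | app hs hu h₁ h₂ =>
      obtain ⟨Δ, Θ, σ, hs', hM, hc, hr⟩ := ih h₁
      obtain ⟨Θ', hs₁, hs₂⟩ := hs.assoc hs'
      refine ⟨Δ, Θ', σ, hs₁, hM, fun s t hst => ?_, fun Γ' Δ' N hs₃ hN => ?_⟩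
      · exact congrArg₂ appL (hc s t fun n hn => hst n (hs₂.ne_none_left hn))
          (h₂.subst_congr fun n hn => hst n (hs₂.ne_none_right hn))
      · obtain ⟨Γ₁, hs₄, hs₅⟩ := hs₃.assoc_symm hs₂
        exact .app hs₄ hu (hr _ _ _ hs₅ hN) h₂
  | letL e N ih =>
    intro Γ M τ h
    cases h with
    | letp hs hu h₁ h₂ =>
      obtain ⟨Δ, Θ, σ, hs', hM, hc, hr⟩ := ih h₁
      obtain ⟨Θ', hs₁, hs₂⟩ := hs.assoc hs'
      refine ⟨Δ, Θ', σ, hs₁, hM, fun s t hst => ?_, fun Γ' Δ' N hs₃ hN => ?_⟩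
      · exact congrArg₂ letL (hc s t fun n hn => hst n (hs₂.ne_none_left hn))
          (h₂.subst_congr (eq_up_of_cons _ (eq_up_of_cons _
            fun n hn => hst n (hs₂.ne_none_right hn))))
      · obtain ⟨Γ₁, hs₄, hs₅⟩ := hs₃.assoc_symm hs₂
        exact .letp hs₄ hu (hr _ _ _ hs₅ hN) h₂
  | appR N e ih =>
    intro Γ M τ h
    cases h with
    | app hs hu h₁ h₂ =>
      obtain ⟨Δ, Θ, σ, hs', hM, hc, hr⟩ := ih h₂
      obtain ⟨Θ', hs₁, hs₂⟩ := hs.symm.assoc hs'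
      refine ⟨Δ, Θ', σ, hs₁, hM, fun s t hst => ?_, fun Γ' Δ' N hs₃ hN => ?_⟩
      · exact congrArg₂ appR (h₁.subst_congr fun n hn => hst n (hs₂.ne_none_right hn))
          (hc s t fun n hn => hst n (hs₂.ne_none_left hn))
      · obtain ⟨Γ₁, hs₄, hs₅⟩ := hs₃.assoc_symm hs₂
        exact .app hs₄.symm hu h₁ (hr _ _ _ hs₅ hN)
  | letPairL e K N ih =>
    intro Γ M τ h
    cases h with
    | letp hs hu h₁ h₂ =>
    cases h₁ with
    | pair hp hv h₃ h₄ =>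
      obtain ⟨Δ, Θ, σ, hs', hM, hc, hr⟩ := ih h₃
      obtain ⟨Θ₁, hs₁, hs₂⟩ := hp.assoc hs'
      obtain ⟨Θ', hs₃, hs₄⟩ := hs.assoc hs₁
      refine ⟨Δ, Θ', σ, hs₃, hM, fun s t hst => ?_, fun Γ' Δ' N hs₅ hN => ?_⟩
      · simp only [subst]
        rw [hc s t fun n hn => hst n (hs₄.ne_none_left (hs₂.ne_none_left hn)),
          h₄.subst_congr fun n hn => hst n (hs₄.ne_none_left (hs₂.ne_none_right hn)),
          h₂.subst_congr (eq_up_of_cons _ (eq_up_of_cons _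
            fun n hn => hst n (hs₄.ne_none_right hn)))]
      · obtain ⟨Γ₁, hs₆, hs₇⟩ := hs₅.assoc_symm hs₄
        obtain ⟨Γ₂, hs₈, hs₉⟩ := hs₇.assoc_symm hs₂
        exact .letp hs₆ hu (.pair hs₈ hv (hr _ _ _ hs₉ hN) h₄) h₂
  | letPairR K e N ih =>
    intro Γ M τ h
    cases h with
    | letp hs hu h₁ h₂ =>
    cases h₁ with
    | pair hp hv h₃ h₄ =>
      obtain ⟨Δ, Θ, σ, hs', hM, hc, hr⟩ := ih h₄
      obtain ⟨Θ₁, hs₁, hs₂⟩ := hp.symm.assoc hs'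
      obtain ⟨Θ', hs₃, hs₄⟩ := hs.assoc hs₁
      refine ⟨Δ, Θ', σ, hs₃, hM, fun s t hst => ?_, fun Γ' Δ' N hs₅ hN => ?_⟩
      · simp only [subst]
        rw [hc s t fun n hn => hst n (hs₄.ne_none_left (hs₂.ne_none_left hn)),
          h₃.subst_congr fun n hn => hst n (hs₄.ne_none_left (hs₂.ne_none_right hn)),
          h₂.subst_congr (eq_up_of_cons _ (eq_up_of_cons _
            fun n hn => hst n (hs₄.ne_none_right hn)))]
      · obtain ⟨Γ₁, hs₆, hs₇⟩ := hs₅.assoc_symm hs₄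
        obtain ⟨Γ₂, hs₈, hs₉⟩ := hs₇.assoc_symm hs₂
        exact .letp hs₆ hu (.pair hs₈.symm hv h₃ (hr _ _ _ hs₉ hN)) h₂

theorem program_plug {e : EvalCtx} {M : Term} {τ : Ty} (h : IsProgram T τ (e.plug M)) :
    ∃ σ, IsProgram T σ M ∧ ∀ N, IsProgram T σ N → IsProgram T τ (e.plug N) := by
  obtain ⟨Δ, Θ, σ, hs, hM, -, hr⟩ := e.plug_inv h
  obtain ⟨rfl, rfl⟩ := hs.of_empty
  exact ⟨σ, hM, fun N hN => hr _ _ _ hs hN⟩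

end EvalCtx

/-- A program in an evaluation position is evaluated first. -/
theorem sem_plug (e : EvalCtx) {M : Term} : ∀ {τ : Ty}, IsProgram T τ (e.plug M) →
    sem (e.plug M) = bind (sem M) fun V => sem (e.plug V) := by
  have values : ∀ {e : EvalCtx} {τ : Ty}, IsProgram T τ (e.plug M) →
      ∀ V ∈ (sem M).support, IsProgram T τ (e.plug V) := by
    intro e τ h V hV
    obtain ⟨σ, hM, hr⟩ := EvalCtx.program_plug h
    exact hr V (hM.of_mem_sem hV).2
  induction e with
  | hole =>
    intro τ h
    have : ∀ V ∈ (sem M).support, sem V = Finsupp.single V 1 := fun V hV =>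
      sem_value (IsProgram.of_mem_sem h hV).1
    simp only [EvalCtx.plug]
    rw [bind_congr this]
    simp [bind]
  | appL e N ih =>
    intro τ h
    have hv := values h
    have hp := h
    cases hp with
    | app hs hu h₁ h₂ =>
      obtain ⟨rfl, rfl⟩ := hs.of_empty
      simp only [EvalCtx.plug] at h hv ⊢
      rw [bind_congr fun V hV => sem_app (hv V hV)]
      rw [sem_app h, ih h₁, bind_bind]
  | letL e N ih =>
    intro τ h
    have hv := values h
    have hp := h
    cases hp with
    | letp hs hu h₁ h₂ =>
      obtain ⟨rfl, rfl⟩ := hs.of_empty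
      simp only [EvalCtx.plug] at h hv ⊢
      rw [bind_congr fun V hV => sem_letp (hv V hV)]
      rw [sem_letp h, ih h₁, bind_bind]
  | appR N e ih =>
    intro τ h
    have hv := values h
    have hp := h
    cases hp with
    | app hs hu h₁ h₂ =>
      obtain ⟨rfl, rfl⟩ := hs.of_empty
      simp only [EvalCtx.plug] at h hv ⊢
      rw [bind_congr fun V hV => sem_app (hv V hV)]
      -- The function is sampled first in `sem_app`, while the claim samples the hole first; the two
      -- samplings are independent.
      rw [sem_app h, ih h₂, bind_comm (sem M)]
      simp only [bind_bind]
  | letPairL e K N ih =>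
    intro τ h
    have hv := values h
    have hp := h
    cases hp with
    | letp hs hu h₁ h₂ =>
    obtain ⟨rfl, rfl⟩ := hs.of_empty
    cases h₁ with
    | pair hp hv' h₃ h₄ =>
      obtain ⟨rfl, rfl⟩ := hp.of_empty
      simp only [EvalCtx.plug] at h hv ⊢
      rw [bind_congr fun V hV => sem_letp_value (V := pair _ _) trivial (hv V hV)]
      rw [sem_letp_value (V := pair _ _) trivial h]
      simp only [letSem]
      rw [ih h₃, bind_bind]
  | letPairR K e N ih =>
    intro τ h
    have hv := values h
    have hp := h
    cases hp with
    | letp hs hu h₁ h₂ =>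
    obtain ⟨rfl, rfl⟩ := hs.of_empty
    cases h₁ with
    | pair hp hv' h₃ h₄ =>
      obtain ⟨rfl, rfl⟩ := hp.of_empty
      simp only [EvalCtx.plug] at h hv ⊢
      rw [bind_congr fun V hV => sem_letp_value (V := pair _ _) trivial (hv V hV)]
      rw [sem_letp_value (V := pair _ _) trivial h]
      simp only [letSem]
      rw [ih h₄, bind_comm (sem M)]
      simp only [bind_bind]

theorem conv_plug (e : EvalCtx) {M : Term} {τ : Ty} (h : IsProgram T τ (e.plug M)) :
    conv (e.plug M) = expect (sem M) fun V => conv (e.plug V) := by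
  simp only [conv, sem_plug e h, weight_eq_expect, expect_bind]

/-- Terms that are values when the variables are (`b`) or are not (`¬ b`) regarded as values. -/
def ValueLike (b : Prop) : Term → Prop
  | var _ => b
  | lam _ => True
  | pair _ _ => True
  | _ => False

/-- The terms that can be in the evaluation position of a typed open term. -/
inductive Redex (b : Prop) : Term → Prop
  | var {i : ℕ} : ¬ b → Redex b (var i)
  | omega : Redex b omega
  | choice {M N : Term} : Redex b (choice M N)
  | beta {L V : Term} : ValueLike b V → Redex b (app (lam L) V)
  | letPair {V W N : Term} : ValueLike b V → ValueLike b W → Redex b (letp (pair V W) N)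
  | appVar {i : ℕ} {V : Term} : b → ValueLike b V → Redex b (app (var i) V)
  | letVar {i : ℕ} {N : Term} : b → Redex b (letp (var i) N)

/-- Every typed open term is a value or has a redex in evaluation position. -/
theorem HasType.decompose (b : Prop) (n : ℕ) : ∀ {Γ : Env Ty} {E : Term} {τ : Ty},
    HasType T Γ E τ → size E ≤ n →
      ValueLike b E ∨ ∃ e r, E = EvalCtx.plug e r ∧ Redex b r := by
  induction n using Nat.strong_induction_on with
  | _ n ih =>
  intro Γ E τ h hn
  cases h with
  | @var _ i =>
    by_cases hb : b
    · exact .inl hb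
    · exact .inr ⟨.hole, _, rfl, .var hb⟩
  | lam => exact .inl trivial
  | pair => exact .inl trivial
  | omega => exact .inr ⟨.hole, _, rfl, .omega⟩
  | choice => exact .inr ⟨.hole, _, rfl, .choice⟩
  | @app _ _ _ M N ρ _ _ hs hu hM hN =>
    rw [size_app] at hn
    right
    obtain hv | ⟨e, r, rfl, hr⟩ := ih (size M) (by omega) hM le_rfl
    · obtain hw | ⟨e, r, rfl, hr⟩ := ih (size N) (by omega) hN le_rfl
      · cases M with
        | var i => exact ⟨.hole, _, rfl, .appVar hv hw⟩
        | lam L => exact ⟨.hole, _, rfl, .beta hw⟩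
        | pair L K => cases hM with | pair _ hu' => rw [hu] at hu'; cases hu'
        | _ => exact hv.elim
      · exact ⟨.appR M e, r, rfl, hr⟩
    · exact ⟨.appL e N, r, rfl, hr⟩
  | @letp _ _ _ M N ρ _ _ _ hs hu hM hN =>
    rw [size_letp] at hn
    right
    obtain hv | ⟨e, r, rfl, hr⟩ := ih (size M) (by omega) hM le_rfl
    · cases M with
      | var i => exact ⟨.hole, _, rfl, .letVar hv⟩
      | lam L => cases hM with | lam hu' => rw [hu] at hu'; cases hu'
      -- A pair under `let` is a redex only once both components are values. The search descends two
      -- constructors here, which an induction on the size permits.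
      | pair L K =>
        rw [size_pair] at hn
        cases hM with
        | pair _ _ hL hK =>
          obtain hv | ⟨e, r, rfl, hr⟩ := ih (size L) (by omega) hL le_rfl
          · obtain hw | ⟨e, r, rfl, hr⟩ := ih (size K) (by omega) hK le_rfl
            · exact ⟨.hole, _, rfl, .letPair hv hw⟩
            · exact ⟨.letPairR L e N, r, rfl, hr⟩
          · exact ⟨.letPairL e K N, r, rfl, hr⟩
      | _ => exact hv.elim
    · exact ⟨.letL e N, r, rfl, hr⟩

/-! ### Tuples -/

theorem getElem?_splitAt {α : Type*} {K : List α} {i : ℕ} (hi : i < K.length) (a b : α) (m : ℕ) :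
    (splitAt K i a b)[m]? =
      if m < i then K[m]? else if m = i then some a else if m = i + 1 then some b
      else K[m - 1]? := by
  have hl : (K.take i).length = i := by simp; omega
  unfold splitAt
  rw [List.getElem?_append, hl]
  split_ifs with h₁ h₂ h₃
  · rw [List.getElem?_take, if_pos h₁]
  · simp [h₂]
  · simp [h₃]
  · obtain ⟨k, rfl⟩ : ∃ k, m = i + 2 + k := ⟨m - (i + 2), by omega⟩
    rw [show i + 2 + k - i = k + 1 + 1 by omega, List.getElem?_cons_succ, List.getElem?_cons_succ,
      List.getElem?_drop]
    congr 1
    omega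

theorem length_filterMap_range {α : Type*} {f : ℕ → Option α} {p : ℕ → Prop} [DecidablePred p]
    (n : ℕ) (hf : ∀ j < n, f j ≠ none ↔ p j) :
    ((List.range n).filterMap f).length = Nat.count p n := by
  induction n with
  | zero => simp
  | succ n ih =>
    rw [List.range_succ, List.filterMap_append, List.length_append, Nat.count_succ,
      ih fun j hj => hf j (by omega)]
    have := hf n (by omega)
    cases h : f n <;> simp_all

/-- The entry `m` of the filtered list comes from the `m`-th position satisfying `p`. Infinitude of
`p` gives `Nat.nth p m` its meaning for every `m`, including indices past the end of the list. -/
theorem getElem?_filterMap_range {α : Type*} {f : ℕ → Option α} {p : ℕ → Prop} [DecidablePred p]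
    (hp : {j | p j}.Infinite) (n : ℕ) (hf : ∀ j < n, f j ≠ none ↔ p j) (m : ℕ) :
    ((List.range n).filterMap f)[m]? = if Nat.nth p m < n then f (Nat.nth p m) else none := by
  induction n with
  | zero => simp
  | succ n ih =>
    have hf' : ∀ j < n, f j ≠ none ↔ p j := fun j hj => hf j (by omega)
    rw [List.range_succ, List.filterMap_append, List.getElem?_append,
      length_filterMap_range n hf']
    by_cases hm : m < Nat.count p n
    · have := Nat.nth_lt_of_lt_count hm
      rw [if_pos hm, ih hf', if_pos this, if_pos (by omega)]
    · rw [if_neg hm]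
      have h₁ : n ≤ Nat.nth p m := (Nat.count_le_iff_le_nth hp).1 (not_lt.1 hm)
      have h₂ := Nat.nth_mem_of_infinite hp m
      have h₃ := hf n (by omega)
      by_cases hn : Nat.nth p m = n
      · have hc : Nat.count p n = m := by rw [← hn, Nat.count_nth_of_infinite hp]
        rw [hn] at h₂ ⊢
        rw [hc, if_pos (by omega)]
        cases hfn : f n <;> simp_all
      · rw [if_neg (by omega)]
        cases hfn : f n with
        | none => simp [hfn]
        | some x =>
          have hpn : p n := h₃.1 (by simp [hfn])
          have : m ≠ Nat.count p n := by
            rintro rfl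
            exact hn (Nat.nth_count hpn)
          simp [hfn]
          omega

/-- The position in a tuple of a component of the contracted tuple. -/
def oldPos (G : Finset ℕ) : ℕ → ℕ := Nat.nth (· ∉ G)

/-- The position in the contracted tuple of a remaining component. -/
def newPos (G : Finset ℕ) : ℕ → ℕ := Nat.count (· ∉ G)

theorem infinite_notMem (G : Finset ℕ) : {j | j ∉ G}.Infinite :=
  (Set.Finite.infinite_compl G.finite_toSet)

theorem oldPos_newPos {G : Finset ℕ} {j : ℕ} (hj : j ∉ G) : oldPos G (newPos G j) = j :=
  Nat.nth_count (p := (· ∉ G)) hj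

theorem newPos_oldPos (G : Finset ℕ) (m : ℕ) : newPos G (oldPos G m) = m :=
  Nat.count_nth_of_infinite (infinite_notMem G) m

theorem oldPos_notMem (G : Finset ℕ) (m : ℕ) : oldPos G m ∉ G :=
  Nat.nth_mem_of_infinite (infinite_notMem G) m

theorem getElem?_contractAt {α : Type*} {K : List α} {G : Finset ℕ} {i : ℕ} (hi : i < K.length)
    (hG : i ∉ G) (a : α) (m : ℕ) :
    (contractAt K G i a)[m]? = if oldPos G m = i then some a else K[oldPos G m]? := by
  unfold contractAt
  rw [getElem?_filterMap_range (p := (· ∉ G)) (infinite_notMem G)]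
  · have := oldPos_notMem G m
    change (if oldPos G m < _ then (if oldPos G m = i then _ else if oldPos G m ∈ G then _ else
      K[oldPos G m]?) else _) = _
    split_ifs with h₁ h₂ h₃
    · rfl
    · rfl
    · omega
    · exact (List.getElem?_eq_none (by omega)).symm
  · intro j hj
    by_cases h : j = i
    · simp [h, hG]
    · by_cases h' : j ∈ G <;> simp [h, h', hj]

/-- The environment of the variables for the components of a tuple. -/
def listEnv (S : List Ty) : Env Ty := fun j => S[j]?

/-- The substitution of the components of a tuple. -/
def tupleSubst (K : List Term) : ℕ → Term := fun j => (K[j]?).getD (var j)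

theorem substTuple_eq (C : Term) (K : List Term) : substTuple C K = subst (tupleSubst K) C := rfl

/-- The first components of `K` are values of the types in `S`. -/
def TupTyped (T : TypeSystem Ty) (S : List Ty) (K : List Term) : Prop :=
  ∀ (j : ℕ) (σ : Ty), S[j]? = some σ → ∃ V, K[j]? = some V ∧ IsValue V ∧ IsProgram T σ V

theorem tupleSubst_of_getElem? {K : List Term} {j : ℕ} {V : Term} (h : K[j]? = some V) :
    tupleSubst K j = V := by
  simp [tupleSubst, h]

theorem lt_length_of_getElem? {α : Type*} {K : List α} {j : ℕ} {V : α} (h : K[j]? = some V) :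
    j < K.length := (List.getElem?_eq_some_iff.1 h).1

theorem HasType.subst_program {Γ : Env Ty} {E : Term} {τ : Ty} (h : HasType T Γ E τ)
    {s : ℕ → Term} (hs : ∀ n σ, Γ n = some σ → IsProgram T σ (s n)) :
    IsProgram T τ (Term.subst s E) :=
  h.subst (o := id) fun n σ hn => (hs n σ hn).hasType _

theorem TupTyped.program {S : List Ty} {K : List Term} (h : TupTyped T S K) (n : ℕ) (σ : Ty)
    (hn : listEnv S n = some σ) : IsProgram T σ (tupleSubst K n) := by
  obtain ⟨V, hV, -, hp⟩ := h n σ hn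
  rwa [tupleSubst_of_getElem? hV]

theorem TupTyped.isValue {S : List Ty} {K : List Term} (h : TupTyped T S K) {n : ℕ} {σ : Ty}
    (hn : listEnv S n = some σ) : IsValue (tupleSubst K n) := by
  obtain ⟨V, hV, hv, -⟩ := h n σ hn
  rwa [tupleSubst_of_getElem? hV]

theorem TupTyped.substTuple {S : List Ty} {K : List Term} (h : TupTyped T S K) {E : Term} {τ : Ty}
    (hE : HasType T (listEnv S) E τ) : IsProgram T τ (substTuple E K) :=
  hE.subst_program h.program

theorem tupTyped_singleton {ρ : Ty} {V : Term} (hv : IsValue V) (hV : IsProgram T ρ V) :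
    TupTyped T [ρ] [V] := by
  intro j σ hj
  cases j with
  | zero => cases hj; exact ⟨V, rfl, hv, hV⟩
  | succ j => simp at hj

theorem TupTyped.splitAt {S : List Ty} {K : List Term} (h : TupTyped T S K) {i : ℕ} {ρ σ τ : Ty}
    (hi : S[i]? = some ρ) {V W : Term} (hv : IsValue V) (hV : IsProgram T σ V)
    (hw : IsValue W) (hW : IsProgram T τ W) :
    TupTyped T (splitAt S i σ τ) (splitAt K i V W) := by
  obtain ⟨_, hK, -⟩ := h i ρ hi
  intro m γ hm
  rw [getElem?_splitAt (lt_length_of_getElem? hi)] at hm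
  rw [getElem?_splitAt (lt_length_of_getElem? hK)]
  split_ifs at hm ⊢
  · exact h _ _ hm
  · cases hm; exact ⟨V, rfl, hv, hV⟩
  · cases hm; exact ⟨W, rfl, hw, hW⟩
  · exact h _ _ hm

theorem TupTyped.contractAt {S : List Ty} {K : List Term} (h : TupTyped T S K) {i : ℕ} {ρ τ : Ty}
    {G : Finset ℕ} (hG : i ∉ G) (hi : S[i]? = some ρ) {V : Term} (hv : IsValue V)
    (hV : IsProgram T τ V) : TupTyped T (contractAt S G i τ) (contractAt K G i V) := by
  obtain ⟨_, hK, -⟩ := h i ρ hi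
  intro m γ hm
  rw [getElem?_contractAt (lt_length_of_getElem? hi) hG] at hm
  rw [getElem?_contractAt (lt_length_of_getElem? hK) hG]
  split_ifs at hm ⊢
  · cases hm; exact ⟨V, rfl, hv, hV⟩
  · exact h _ _ hm

theorem IsProgram.eq_lam {V : Term} {ρ σ τ : Ty} (h : IsProgram T ρ V) (hv : IsValue V)
    (hu : T.unfold ρ = .arrow σ τ) : ∃ L, V = lam L := by
  cases V with
  | lam L => exact ⟨L, rfl⟩
  | pair L K => cases h with | pair _ hu' => rw [hu] at hu'; cases hu'
  | _ => exact hv.elim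

theorem IsProgram.eq_pair {V : Term} {ρ σ τ : Ty} (h : IsProgram T ρ V) (hv : IsValue V)
    (hu : T.unfold ρ = .tensor σ τ) : ∃ L K, V = pair L K := by
  cases V with
  | pair L K => exact ⟨L, K, rfl⟩
  | lam L => cases h with | lam hu' => rw [hu] at hu'; cases hu'
  | _ => exact hv.elim

theorem TupTyped.exists_lam {S : List Ty} {K : List Term} (h : TupTyped T S K) {i : ℕ}
    {ρ σ τ : Ty} (hi : S[i]? = some ρ) (hu : T.unfold ρ = .arrow σ τ) :
    ∃ N, K[i]? = some (lam N) ∧ HasType T (cons σ Env.empty) N τ := by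
  obtain ⟨V, hV, hv, hp⟩ := h i ρ hi
  obtain ⟨N, rfl⟩ := hp.eq_lam hv hu
  exact ⟨N, hV, HasType.lam_inv hp hu⟩

theorem TupTyped.exists_pair {S : List Ty} {K : List Term} (h : TupTyped T S K) {i : ℕ}
    {ρ σ τ : Ty} (hi : S[i]? = some ρ) (hu : T.unfold ρ = .tensor σ τ) :
    ∃ N L, K[i]? = some (pair N L) ∧ IsProgram T σ N ∧ IsProgram T τ L := by
  obtain ⟨V, hV, hv, hp⟩ := h i ρ hi
  obtain ⟨N, L, rfl⟩ := hp.eq_pair hv hu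
  exact ⟨N, L, hV, HasType.pair_inv hp hu⟩

theorem expect_tupStep_cut {K : List Term} {i : ℕ} {N L : Term} (h : K[i]? = some (pair N L))
    (f : List Term → ℝ) : expect (tupStep K (.cut i)) f =
      expect (sem N) fun V => expect (sem L) fun W => f (splitAt K i V W) := by
  simp [tupStep, h, expect_bind]

theorem expect_tupStep_appl {K : List Term} {G : Finset ℕ} {C : Term} {i : ℕ} {N : Term}
    (h : K[i]? = some (lam N)) (f : List Term → ℝ) : expect (tupStep K (.appl G C i)) f =
      expect (sem (inst N (substTuple C K))) fun W => f (contractAt K G i W) := by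
  simp [tupStep, h, expect_bind]

theorem mem_tupStep_cut {K K' : List Term} {i : ℕ} {N L : Term} (h : K[i]? = some (pair N L))
    (hK : K' ∈ (tupStep K (.cut i)).support) :
    ∃ V ∈ (sem N).support, ∃ W ∈ (sem L).support, K' = splitAt K i V W := by
  simp only [tupStep, h] at hK
  obtain ⟨V, hV, hK⟩ := exists_mem_support_of_mem_bind hK
  obtain ⟨W, hW, hK⟩ := exists_mem_support_of_mem_bind hK
  exact ⟨V, hV, W, hW, Finset.mem_singleton.1 (Finsupp.support_single_subset hK)⟩

theorem mem_tupStep_appl {K K' : List Term} {G : Finset ℕ} {C : Term} {i : ℕ} {N : Term}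
    (h : K[i]? = some (lam N)) (hK : K' ∈ (tupStep K (.appl G C i)).support) :
    ∃ W ∈ (sem (inst N (substTuple C K))).support, K' = contractAt K G i W := by
  simp only [tupStep, h] at hK
  obtain ⟨W, hW, hK⟩ := exists_mem_support_of_mem_bind hK
  exact ⟨W, hW, Finset.mem_singleton.1 (Finsupp.support_single_subset hK)⟩

/-! ### Reduction of open terms -/

theorem ValueLike.isValue_subst {b : Prop} {Γ : Env Ty} {V : Term} {τ : Ty} (h : ValueLike b V)
    (hV : HasType T Γ V τ) {s : ℕ → Term} (hs : b → ∀ n σ, Γ n = some σ → IsValue (s n)) :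
    IsValue (subst s V) := by
  cases V with
  | var i => cases hV with | var hi => exact hs h _ _ hi
  | lam => trivial
  | pair => trivial
  | _ => exact h.elim

section Reduction

variable {Γ : Env Ty} {e : EvalCtx} {τ : Ty} {s : ℕ → Term}

theorem conv_subst_plug {M : Term} (h : HasType T Γ (e.plug M) τ)
    (hs : ∀ n σ, Γ n = some σ → IsProgram T σ (s n)) :
    conv (subst s (e.plug M)) =
      expect (sem (subst s M)) fun V => conv ((e.subst s).plug V) := by
  have := h.subst_program hs
  rw [e.subst_plug] at this ⊢
  exact conv_plug _ this

theorem conv_subst_plug_congr {M N : Term} (hM : HasType T Γ (e.plug M) τ)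
    (hN : HasType T Γ (e.plug N) τ) (hs : ∀ n σ, Γ n = some σ → IsProgram T σ (s n))
    (h : ∀ σ, IsProgram T σ (subst s M) → sem (subst s M) = sem (subst s N)) :
    conv (subst s (e.plug M)) = conv (subst s (e.plug N)) := by
  have h₁ := hM.subst_program hs
  rw [e.subst_plug] at h₁
  obtain ⟨σ, hσ, -⟩ := EvalCtx.program_plug h₁
  rw [conv_subst_plug hM hs, conv_subst_plug hN hs, h σ hσ]

theorem conv_subst_plug_omega (h : HasType T Γ (e.plug omega) τ)
    (hs : ∀ n σ, Γ n = some σ → IsProgram T σ (s n)) : conv (subst s (e.plug omega)) = 0 := by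
  rw [conv_subst_plug h hs]
  simp [subst, sem_omega]

theorem HasType.plug_choice {M N : Term} (h : HasType T Γ (e.plug (Term.choice M N)) τ) :
    HasType T Γ (e.plug M) τ ∧ HasType T Γ (e.plug N) τ := by
  obtain ⟨Δ, Θ, σ, hs, hM, -, hr⟩ := e.plug_inv h
  cases hM with
  | choice h₁ h₂ => exact ⟨hr _ _ _ hs h₁, hr _ _ _ hs h₂⟩

theorem conv_subst_plug_choice {M N : Term} (h : HasType T Γ (e.plug (Term.choice M N)) τ)
    (hs : ∀ n σ, Γ n = some σ → IsProgram T σ (s n)) :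
    conv (subst s (e.plug (Term.choice M N))) =
      1 / 2 * conv (subst s (e.plug M)) + 1 / 2 * conv (subst s (e.plug N)) := by
  have h₁ := h.subst_program hs
  rw [e.subst_plug] at h₁
  obtain ⟨σ, hσ, -⟩ := EvalCtx.program_plug h₁
  rw [conv_subst_plug h hs, conv_subst_plug h.plug_choice.1 hs,
    conv_subst_plug h.plug_choice.2 hs, subst, sem_choice hσ, expect_half]

theorem HasType.plug_beta {L V : Term} (h : HasType T Γ (e.plug (Term.app (Term.lam L) V)) τ) :
    HasType T Γ (e.plug (Term.inst L V)) τ ∧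
      size (e.plug (Term.inst L V)) < size (e.plug (Term.app (Term.lam L) V)) := by
  obtain ⟨Δ, Θ, σ, hs, hM, -, hr⟩ := e.plug_inv h
  cases hM with
  | app hs' hu h₁ h₂ =>
    have hL := h₁.lam_inv hu
    refine ⟨hr _ _ _ hs (HasType.inst hs' hL h₂), e.size_plug_lt ?_⟩
    have := hL.size_inst_le V
    rw [size_app, size_lam]
    omega

theorem conv_subst_plug_beta {L V : Term} (h : HasType T Γ (e.plug (Term.app (Term.lam L) V)) τ)
    (hs : ∀ n σ, Γ n = some σ → IsProgram T σ (s n)) (hV : IsValue (subst s V)) :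
    conv (subst s (e.plug (Term.app (Term.lam L) V))) = conv (subst s (e.plug (inst L V))) := by
  refine conv_subst_plug_congr h h.plug_beta.1 hs fun σ hp => ?_
  rw [subst_inst]
  exact sem_app_value trivial hV hp

theorem HasType.plug_letPair {V W N : Term}
    (h : HasType T Γ (e.plug (Term.letp (Term.pair V W) N)) τ) :
    HasType T Γ (e.plug (Term.inst₂ N V W)) τ ∧
      size (e.plug (Term.inst₂ N V W)) < size (e.plug (Term.letp (Term.pair V W) N)) := by
  obtain ⟨Δ, Θ, σ, hs, hM, -, hr⟩ := e.plug_inv h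
  cases hM with
  | letp hs' hu h₁ h₂ =>
    cases h₁ with
    | pair hp hu' h₃ h₄ =>
      rw [hu] at hu'
      cases hu'
      refine ⟨hr _ _ _ hs (HasType.inst₂ hs' hp h₂ h₃ h₄), e.size_plug_lt ?_⟩
      have := h₂.size_inst₂_le V W
      rw [size_letp, size_pair]
      omega

theorem conv_subst_plug_letPair {V W N : Term}
    (h : HasType T Γ (e.plug (Term.letp (Term.pair V W) N)) τ)
    (hs : ∀ n σ, Γ n = some σ → IsProgram T σ (s n)) (hV : IsValue (subst s V))
    (hW : IsValue (subst s W)) :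
    conv (subst s (e.plug (Term.letp (Term.pair V W) N))) =
      conv (subst s (e.plug (inst₂ N V W))) := by
  refine conv_subst_plug_congr h h.plug_letPair.1 hs fun σ hp => ?_
  rw [subst_inst₂, subst, sem_letp_value (V := subst s (Term.pair V W)) trivial hp]
  simp only [subst, letSem]
  rw [sem_value hV, sem_value hW, bind_single, bind_single]

end Reduction

/-! ### Non-expansive tests and the simulation of open terms by tuple actions. -/

namespace Env

def union (Δ Θ : Env Ty) : Env Ty := fun n => (Δ n).or (Θ n)

theorem split_union {Δ Θ : Env Ty} (h : ∀ n, Δ n = none ∨ Θ n = none) :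
    Split (union Δ Θ) Δ Θ := by
  intro n
  rcases h n with h | h
  · exact .inr ⟨h, by simp [union, h]⟩
  · exact .inl ⟨by simp [union, h], h⟩

theorem union_eq_some {Δ Θ : Env Ty} {n : ℕ} {σ : Ty} (h : union Δ Θ n = some σ) :
    Δ n = some σ ∨ Θ n = some σ := by
  unfold union at h
  cases hd : Δ n <;> simp_all

theorem union_eq_none {Δ Θ : Env Ty} {n : ℕ} : union Δ Θ n = none ↔ Δ n = none ∧ Θ n = none := by
  simp [union]

def single (i : ℕ) (σ : Ty) : Env Ty := fun n => if n = i then some σ else none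

theorem single_self (i : ℕ) (σ : Ty) : single i σ i = some σ := if_pos rfl

theorem single_eq_some {i n : ℕ} {σ τ : Ty} (h : single i σ n = some τ) : n = i ∧ σ = τ := by
  unfold single at h; split_ifs at h; simp_all

theorem single_ne {i n : ℕ} {σ : Ty} (h : n ≠ i) : single i σ n = none := if_neg h

end Env

/-- The test `f` on tuples of type `S` distinguishes distributions of such tuples no better than
the tuple traces do. -/
def NonExpansive (T : TypeSystem Ty) (S : List Ty) (f : List Term → ℝ) : Prop :=
  ∀ (μ : List Term →₀ ℝ) (r : ℝ), (∀ K ∈ μ.support, TupTyped T S K) →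
    (∀ s, TupTraceTyped T S s → |expect μ (tupProb s)| ≤ r) → |expect μ f| ≤ r

namespace NonExpansive

variable {S : List Ty} {f g : List Term → ℝ}

theorem congr (h : NonExpansive T S g) (hfg : ∀ K, TupTyped T S K → f K = g K) :
    NonExpansive T S f := by
  intro μ r hμ hr
  rw [expect_congr fun K hK => hfg K (hμ K hK)]
  exact h μ r hμ hr

/-- The constant 1 is the acceptance probability of the empty trace. -/
theorem one : NonExpansive T S fun _ => 1 := fun _ _ _ hr => hr [] .nil

theorem zero : NonExpansive T S fun _ => 0 := by
  intro μ r _ hr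
  rw [expect_const_zero, abs_zero]
  exact (abs_nonneg _).trans (hr [] .nil)

theorem half (hf : NonExpansive T S f) (hg : NonExpansive T S g) :
    NonExpansive T S fun K => 1 / 2 * f K + 1 / 2 * g K := by
  intro μ r hμ hr
  rw [expect_add, expect_mul_left, expect_mul_left]
  have h₁ := abs_le.1 (hf μ r hμ hr)
  have h₂ := abs_le.1 (hg μ r hμ hr)
  exact abs_le.2 ⟨by linarith, by linarith⟩

/-- Pushing `μ` forward along the action `a` gives a measure whose trace `s` has the value of the
trace `a :: s` under `μ`, so the bound `r` is inherited. -/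
theorem step {S' : List Ty} {a : TupAct} (hf : NonExpansive T S' f)
    (ht : ∀ s, TupTraceTyped T S' s → TupTraceTyped T S (a :: s))
    (hK : ∀ K, TupTyped T S K → ∀ K' ∈ (tupStep K a).support, TupTyped T S' K') :
    NonExpansive T S fun K => expect (tupStep K a) f := by
  intro μ r hμ hr
  have := hf (bind μ fun K => tupStep K a) r (fun K' hK' => by
    obtain ⟨K, h, h'⟩ := exists_mem_support_of_mem_bind hK'
    exact hK K (hμ K h) K' h') fun s hs => by
      rw [expect_bind]
      exact hr (a :: s) (ht s hs)
  rwa [expect_bind] at this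

end NonExpansive

/-- Passing the argument `C` to the component `i` can be simulated by a tuple action. -/
theorem exists_reduct_appVar {S : List Ty} {e : EvalCtx} {i : ℕ} {C : Term} {τ : Ty}
    (h : HasType T (listEnv S) (e.plug (app (var i) C)) τ) (hC : ValueLike True C) :
    ∃ S' a E', (∀ s, TupTraceTyped T S' s → TupTraceTyped T S (a :: s)) ∧
      (∀ K, TupTyped T S K → ∀ K' ∈ (tupStep K a).support, TupTyped T S' K') ∧
      HasType T (listEnv S') E' τ ∧ size E' < size (e.plug (app (var i) C)) ∧
      ∀ K, TupTyped T S K → conv (substTuple (e.plug (app (var i) C)) K) =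
        expect (tupStep K a) fun K' => conv (substTuple E' K') := by
  classical
  obtain ⟨Δ, Θ, γ, hs, hM, hc, hr⟩ := e.plug_inv h
  cases hM with
  | @app _ Δ₁ Δ₂ _ _ ρ σ _ hs' hu h₁ h₂ =>
  cases h₁ with
  | var hi =>
  have hiΔ := hs'.left hi
  have hiS := hs.left hiΔ.1
  have hi' : S[i]? = some ρ := hiS.1
  -- The components that the argument owns; they are consumed by the action.
  set G : Finset ℕ := (Finset.range S.length).filter fun j => Δ₂ j ≠ none with hG
  have hiG : i ∉ G := by simp [hG, hiΔ.2]
  have hGS : ∀ j γ, Δ₂ j = some γ → j ∈ G ∧ S[j]? = some γ := by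
    intro j γ hj
    have hj' : S[j]? = some γ := (hs.left (hs'.right hj).1).1
    exact ⟨by simp [hG, hj, lt_length_of_getElem? hj'], hj'⟩
  have hCo : HasType T (fun j => if j ∈ G then S[j]? else none) C σ :=
    h₂.weaken fun j γ hj => by
      obtain ⟨k₁, k₂⟩ := hGS j γ hj
      simp only [k₁, k₂, if_true]
  have hΘG : ∀ j, Θ j ≠ none → j ∉ G ∧ j ≠ i := by
    intro j hj
    obtain ⟨δ, hδ⟩ := Option.ne_none_iff_exists'.1 hj
    have hΔ := (hs.right hδ).2
    refine ⟨fun hjG => ?_, fun hji => by simp [hji, hiΔ.1] at hΔ⟩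
    obtain ⟨ε, hε⟩ := Option.ne_none_iff_exists'.1 (Finset.mem_filter.1 hjG).2
    simp [(hs'.right hε).1] at hΔ
  -- The result of the application takes the place of component `i`, so the variable `i` itself
  -- replaces the redex. The evaluation context uses neither `i` nor the components in `G`.
  have hE : HasType T (union (single i γ) Θ) (e.plug (var i)) τ := by
    refine hr _ _ _ (split_union fun n => ?_) (.var (single_self i γ))
    by_cases hn : n = i
    · exact .inr (hn ▸ hiS.2)
    · exact .inl (single_ne hn)
  -- Deleting the components in `G` shifts the remaining ones, hence the renaming to new positions.
  have hE' : HasType T (listEnv (contractAt S G i γ)) (rename (newPos G) (e.plug (var i))) τ := by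
    refine hE.rename (o := oldPos G) fun n δ hn => ?_
    unfold listEnv
    rw [getElem?_contractAt (lt_length_of_getElem? hi') hiG]
    rcases union_eq_some hn with hn | hn
    · obtain ⟨rfl, rfl⟩ := single_eq_some hn
      rw [oldPos_newPos hiG]
      simp
    · obtain ⟨k₁, k₂⟩ := hΘG n (by simp [hn])
      rw [oldPos_newPos k₁, if_neg k₂]
      exact ⟨(hs.right hn).1, rfl⟩
  have hprog : ∀ K, TupTyped T S K → ∀ N, K[i]? = some (lam N) →
      IsProgram T γ (app (lam N) (substTuple C K)) := by
    intro K hK N hN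
    have := (HasType.app hs' hu (.var hi) h₂).subst_program (s := tupleSubst K) fun n σ hn =>
      hK.program n σ (hs.left hn).1
    rwa [subst, subst, tupleSubst_of_getElem? hN] at this
  have hval : ∀ K, TupTyped T S K → IsValue (substTuple C K) := fun K hK =>
    hC.isValue_subst h₂ fun _ n σ hn => hK.isValue (hs.left (hs'.right hn).1).1
  have hCv : IsOpenValue C := by cases C <;> trivial
  refine ⟨contractAt S G i γ, .appl G C i, rename (newPos G) (e.plug (var i)), fun s hs => ?_,
    fun K hK K' hK' => ?_, hE', ?_, fun K hK => ?_⟩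
  · refine .appl hi' hu (fun j hj => ⟨?_, fun hji => hiG (hji ▸ hj)⟩) hCv hCo hs
    exact Finset.mem_range.1 (Finset.mem_filter.1 hj).1
  · obtain ⟨N, hN, hNt⟩ := hK.exists_lam hi' hu
    obtain ⟨W, hW, rfl⟩ := mem_tupStep_appl hN hK'
    have := hprog K hK N hN
    rw [← appSem, ← sem_app_value (V := lam N) trivial (hval K hK) this] at hW
    obtain ⟨k₁, k₂⟩ := this.of_mem_sem hW
    exact hK.contractAt hiG hi' k₁ k₂
  · rw [size_rename]
    exact e.size_plug_lt (by rw [size_app, size_var]; omega)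
  · obtain ⟨N, hN, hNt⟩ := hK.exists_lam hi' hu
    rw [expect_tupStep_appl hN, substTuple_eq, conv_subst_plug h hK.program, subst, subst,
      tupleSubst_of_getElem? hN, ← substTuple_eq C K, sem_app_value (V := lam N) trivial (hval K hK)
      (hprog K hK N hN)]
    refine expect_congr fun W _ => ?_
    rw [substTuple_eq, subst_rename, EvalCtx.subst_plug]
    have hnew : ∀ n, n ∉ G → (contractAt K G i W)[newPos G n]? = if n = i then some W else K[n]? :=
      fun n hn => by
        rw [getElem?_contractAt (lt_length_of_getElem? hN) hiG, oldPos_newPos hn]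
    congr 2
    · refine hc _ _ fun n hn => ?_
      obtain ⟨k₁, k₂⟩ := hΘG n hn
      obtain ⟨δ, hδ⟩ := Option.ne_none_iff_exists'.1 hn
      obtain ⟨V, hV, -⟩ := hK n δ (hs.right hδ).1
      have := hnew n k₁
      rw [if_neg k₂, hV] at this
      rw [tupleSubst_of_getElem? hV, Function.comp, tupleSubst_of_getElem? this]
    · have := hnew i hiG
      rw [if_pos rfl] at this
      exact (tupleSubst_of_getElem? this).symm

/-- Eliminating the component `i` can be simulated by a tuple action. -/
theorem exists_reduct_letVar {S : List Ty} {e : EvalCtx} {i : ℕ} {N : Term} {τ : Ty}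
    (h : HasType T (listEnv S) (e.plug (letp (var i) N)) τ) :
    ∃ S' a E', (∀ s, TupTraceTyped T S' s → TupTraceTyped T S (a :: s)) ∧
      (∀ K, TupTyped T S K → ∀ K' ∈ (tupStep K a).support, TupTyped T S' K') ∧
      HasType T (listEnv S') E' τ ∧ size E' < size (e.plug (letp (var i) N)) ∧
      ∀ K, TupTyped T S K → conv (substTuple (e.plug (letp (var i) N)) K) =
        expect (tupStep K a) fun K' => conv (substTuple E' K') := by
  classical
  obtain ⟨Δ, Θ, γ, hs, hM, hc, hr⟩ := e.plug_inv h
  cases hM with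
  | @letp _ Δ₁ Δ₂ _ _ ρ σ₁ σ₂ _ hs' hu h₁ h₂ =>
  cases h₁ with
  | var hi =>
  have hiΔ := hs'.left hi
  have hiS := hs.left hiΔ.1
  have hi' : S[i]? = some ρ := hiS.1
  have hil := lt_length_of_getElem? hi'
  -- The first component of the pair keeps the name `i`; the index `n`, beyond the tuple, is a fresh
  -- name for the second.
  set n := S.length with hn
  have hSn : ∀ δ, listEnv S n ≠ some δ := fun δ hδ => by
    have := lt_length_of_getElem? hδ
    omega
  have hΔn : ∀ δ, Δ n ≠ some δ := fun δ hδ => hSn δ (hs.left hδ).1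
  have hΔ₂n : ∀ δ, Δ₂ n ≠ some δ := fun δ hδ => hΔn δ (hs'.right hδ).1
  have hΘn : ∀ δ, Θ n ≠ some δ := fun δ hδ => hSn δ (hs.right hδ).1
  have hpair : Split (union (single i σ₁) (single n σ₂)) (single i σ₁) (single n σ₂) := by
    refine split_union fun m => ?_
    by_cases hm : m = i
    · exact .inr (single_ne (by omega))
    · exact .inl (single_ne hm)
  have hB : HasType T (union (union (single i σ₁) (single n σ₂)) Δ₂)
      (inst₂ N (var i) (var n)) γ := by
    refine HasType.inst₂ (split_union fun m => ?_) hpair h₂ (.var (single_self _ _))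
      (.var (single_self _ _))
    by_cases hm : m = i
    · exact .inr (hm ▸ hiΔ.2)
    · by_cases hm' : m = n
      · exact .inr (hm' ▸ Option.eq_none_iff_forall_ne_some.2 hΔ₂n)
      · exact .inl (union_eq_none.2 ⟨single_ne hm, single_ne hm'⟩)
  have hE : HasType T (union (union (union (single i σ₁) (single n σ₂)) Δ₂) Θ)
      (e.plug (inst₂ N (var i) (var n))) τ := by
    refine hr _ _ _ (split_union fun m => ?_) hB
    by_cases hm : m = i
    · exact .inr (hm ▸ hiS.2)
    · by_cases hm' : m = n
      · exact .inr (hm' ▸ Option.eq_none_iff_forall_ne_some.2 hΘn)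
      · by_cases hm₂ : Δ₂ m = none
        · exact .inl (union_eq_none.2 ⟨union_eq_none.2 ⟨single_ne hm, single_ne hm'⟩, hm₂⟩)
        · obtain ⟨δ, hδ⟩ := Option.ne_none_iff_exists'.1 hm₂
          exact .inr (hs.left (hs'.right hδ).1).2
  have hrest : ∀ m δ, Δ₂ m = some δ ∨ Θ m = some δ → S[m]? = some δ ∧ m ≠ i ∧ m < n := by
    rintro m δ (hm | hm)
    · have hm' : S[m]? = some δ := (hs.left (hs'.right hm).1).1
      refine ⟨hm', ?_, lt_length_of_getElem? hm'⟩
      rintro rfl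
      simp [hiΔ.2] at hm
    · have hm' : S[m]? = some δ := (hs.right hm).1
      refine ⟨hm', ?_, lt_length_of_getElem? hm'⟩
      rintro rfl
      simp [hiS.2] at hm
  -- The positions after the split: the fresh variable comes to stand right after `i`, and later
  -- components move up by one.
  set r : ℕ → ℕ := fun m => if m = n then i + 1 else if m ≤ i then m else m + 1 with hrdef
  have hri : r i = i := by simp [hrdef]; omega
  have hr_le : ∀ m, m < n → m ≤ i → r m = m := fun m h h' =>
    (if_neg (by omega)).trans (if_pos h')
  have hr_gt : ∀ m, m < n → i < m → r m = m + 1 := fun m h h' =>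
    (if_neg (by omega)).trans (if_neg (by omega))
  have hrn : r n = i + 1 := by simp [hrdef]
  have hE' : HasType T (listEnv (splitAt S i σ₁ σ₂))
      (rename r (e.plug (inst₂ N (var i) (var n)))) τ := by
    refine hE.rename (o := fun m => if m ≤ i then m else if m = i + 1 then n else m - 1)
      fun m δ hm => ?_
    unfold listEnv
    rw [getElem?_splitAt hil]
    have hm' : (single i σ₁ m = some δ ∨ single n σ₂ m = some δ) ∨
        (Δ₂ m = some δ ∨ Θ m = some δ) := by
      rcases union_eq_some hm with hm | hm
      · rcases union_eq_some hm with hm | hm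
        · exact .inl (union_eq_some hm)
        · exact .inr (.inl hm)
      · exact .inr (.inr hm)
    rcases hm' with (hm | hm) | hm
    · obtain ⟨rfl, rfl⟩ := single_eq_some hm
      simp [hri]
    · obtain ⟨rfl, rfl⟩ := single_eq_some hm
      simp [hrn]
    · obtain ⟨k₁, k₂, k₃⟩ := hrest m δ hm
      by_cases hmi : m < i
      · have := hr_le m k₃ (by omega)
        rw [this, if_pos hmi, if_pos (by omega)]
        exact ⟨k₁, rfl⟩
      · have := hr_gt m k₃ (by omega)
        rw [this, if_neg (by omega), if_neg (by omega), if_neg (by omega), if_neg (by omega),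
          if_neg (by omega)]
        exact ⟨k₁, rfl⟩
  have hmem : ∀ K, TupTyped T S K → ∀ N₁ N₂, IsProgram T σ₁ N₁ → IsProgram T σ₂ N₂ →
      ∀ V ∈ (sem N₁).support, ∀ W ∈ (sem N₂).support,
        TupTyped T (splitAt S i σ₁ σ₂) (splitAt K i V W) := by
    intro K hK N₁ N₂ hN₁ hN₂ V hV W hW
    exact hK.splitAt hi' (hN₁.of_mem_sem hV).1 (hN₁.of_mem_sem hV).2 (hN₂.of_mem_sem hW).1
      (hN₂.of_mem_sem hW).2
  refine ⟨splitAt S i σ₁ σ₂, .cut i, _, fun s hs => .cut hi' hu hs,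
    fun K hK K' hK' => ?_, hE', ?_, fun K hK => ?_⟩
  · obtain ⟨N₁, N₂, hN, hN₁, hN₂⟩ := hK.exists_pair hi' hu
    obtain ⟨V, hV, W, hW, rfl⟩ := mem_tupStep_cut hN hK'
    exact hmem K hK N₁ N₂ hN₁ hN₂ V hV W hW
  · rw [size_rename]
    refine e.size_plug_lt ?_
    have := h₂.size_inst₂_le (var i) (var n)
    rw [size_var, size_var] at this
    rw [size_letp, size_var]
    omega
  · obtain ⟨N₁, N₂, hN, hN₁, hN₂⟩ := hK.exists_pair hi' hu
    have hp : IsProgram T γ (letp (pair N₁ N₂) (subst (up (up (tupleSubst K))) N)) := by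
      have := (HasType.letp hs' hu (.var hi) h₂).subst_program (s := tupleSubst K) fun n σ hn =>
        hK.program n σ (hs.left hn).1
      rwa [subst, subst, tupleSubst_of_getElem? hN] at this
    rw [expect_tupStep_cut hN, substTuple_eq, conv_subst_plug h hK.program, subst, subst,
      tupleSubst_of_getElem? hN, sem_letp_value (V := pair N₁ N₂) trivial hp, letSem, expect_bind]
    refine expect_congr fun V hV => ?_
    rw [expect_bind]
    refine expect_congr fun W hW => ?_
    have hK' := hmem K hK N₁ N₂ hN₁ hN₂ V hV W hW
    have hE'' := hK'.substTuple hE'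
    have hnew : ∀ m, (splitAt K i V W)[m]? = _ := getElem?_splitAt (lt_length_of_getElem? hN) V W
    have hsub : ∀ m δ, Δ₂ m = some δ ∨ Θ m = some δ →
        tupleSubst K m = tupleSubst (splitAt K i V W) (r m) := by
      intro m δ hm
      obtain ⟨k₁, k₂, k₃⟩ := hrest m δ hm
      obtain ⟨V', hV', -⟩ := hK m δ k₁
      rw [tupleSubst_of_getElem? hV']
      refine (tupleSubst_of_getElem? ?_).symm
      rw [hnew, ← hV']
      by_cases hmi : m < i
      · have := hr_le m k₃ (by omega)
        rw [this, if_pos hmi]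
      · have := hr_gt m k₃ (by omega)
        rw [this, if_neg (by omega), if_neg (by omega), if_neg (by omega)]
        rfl
    rw [substTuple_eq, subst_rename, EvalCtx.subst_plug] at hE'' ⊢
    rw [conv_plug _ hE'', subst_inst₂]
    have e₁ : e.subst (tupleSubst K) = e.subst (tupleSubst (splitAt K i V W) ∘ r) :=
      hc _ _ fun m hm => by
        obtain ⟨δ, hδ⟩ := Option.ne_none_iff_exists'.1 hm
        exact hsub m δ (.inr hδ)
    have e₂ : subst (up (up (tupleSubst K))) N =
        subst (up (up (tupleSubst (splitAt K i V W) ∘ r))) N :=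
      h₂.subst_congr (eq_up_of_cons _ (eq_up_of_cons _ fun m hm => by
        obtain ⟨δ, hδ⟩ := Option.ne_none_iff_exists'.1 hm
        exact hsub m δ (.inl hδ)))
    have e₃ : (splitAt K i V W)[r i]? = some V := by rw [hnew, hri]; simp
    have e₄ : (splitAt K i V W)[r n]? = some W := by rw [hnew, hrn]; simp
    rw [e₁, e₂, subst, subst, Function.comp, Function.comp, tupleSubst_of_getElem? e₃,
      tupleSubst_of_getElem? e₄]

/-- Observing the convergence of an open term is a non-expansive test. -/
theorem nonExpansive_conv (n : ℕ) : ∀ {S : List Ty} {E : Term} {τ : Ty},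
    HasType T (listEnv S) E τ → size E ≤ n →
      NonExpansive T S fun K => conv (substTuple E K) := by
  induction n using Nat.strong_induction_on with
  | _ n ih =>
  intro S E τ h hn
  -- Variables count as values, since they stand for components of a tuple. An open value converges
  -- with probability 1 on every tuple, so it tests nothing.
  obtain hv | ⟨e, r, rfl, hr⟩ := h.decompose True _ le_rfl
  · exact NonExpansive.one.congr fun K hK =>
      conv_value (hv.isValue_subst h fun _ n σ hn => hK.isValue hn)
  have value : ∀ {V : Term} {Γ : Env Ty} {σ : Ty}, ValueLike True V → HasType T Γ V σ →
      (∀ n σ, Γ n = some σ → listEnv S n = some σ) → ∀ K, TupTyped T S K →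
      IsValue (subst (tupleSubst K) V) := fun hV hVt hΓ K hK =>
    hV.isValue_subst hVt fun _ n σ hn => hK.isValue (hΓ n σ hn)
  have hinv := e.plug_inv h
  cases hr with
  | var hb => exact absurd trivial hb
  | omega => exact NonExpansive.zero.congr fun K hK => conv_subst_plug_omega h hK.program
  | @choice M N =>
    refine (NonExpansive.half (ih (size (e.plug M)) ?_ h.plug_choice.1 le_rfl)
      (ih (size (e.plug N)) ?_ h.plug_choice.2 le_rfl)).congr fun K hK =>
        conv_subst_plug_choice h hK.program
    · exact (e.size_plug_lt (by rw [size_choice]; omega)).trans_le hn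
    · exact (e.size_plug_lt (by rw [size_choice]; omega)).trans_le hn
  | @beta L V hV =>
    refine (ih _ (h.plug_beta.2.trans_le hn) h.plug_beta.1 le_rfl).congr fun K hK =>
      conv_subst_plug_beta h hK.program ?_
    obtain ⟨Δ, Θ, σ, hs, hM, -⟩ := hinv
    cases hM with
    | app hs' hu h₁ h₂ =>
      exact value hV h₂ (fun n σ hn => (hs.left (hs'.right hn).1).1) K hK
  | @letPair V W N hV hW =>
    obtain ⟨Δ, Θ, σ, hs, hM, -⟩ := hinv
    cases hM with
    | letp hs' hu h₁ h₂ =>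
    cases h₁ with
    | pair hp hu' h₃ h₄ =>
    exact (ih _ (h.plug_letPair.2.trans_le hn) h.plug_letPair.1 le_rfl).congr fun K hK =>
      conv_subst_plug_letPair h hK.program
        (value hV h₃ (fun n σ hn => (hs.left (hs'.left (hp.left hn).1).1).1) K hK)
        (value hW h₄ (fun n σ hn => (hs.left (hs'.left (hp.right hn).1).1).1) K hK)
  | appVar _ hC =>
    obtain ⟨S', a, E', h₁, h₂, h₃, h₄, h₅⟩ := exists_reduct_appVar h hC
    exact ((ih _ (h₄.trans_le hn) h₃ le_rfl).step h₁ h₂).congr h₅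
  | letVar _ =>
    obtain ⟨S', a, E', h₁, h₂, h₃, h₄, h₅⟩ := exists_reduct_letVar h
    exact ((ih _ (h₄.trans_le hn) h₃ le_rfl).step h₁ h₂).congr h₅

/-- Programs that tuple traces distinguish by at most `r` are distinguished by at most `r` when
substituted for a variable. -/
theorem abs_conv_sub_le {θ : Ty} {M N : Term} (hM : IsProgram T θ M) (hN : IsProgram T θ N)
    {r : ℝ} (hr : ∀ s, TupTraceTyped T [θ] s →
      |expect (sem M) (fun V => tupProb s [V]) - expect (sem N) (fun W => tupProb s [W])| ≤ r)
    (n : ℕ) : ∀ {E : Term} {τ : Ty}, HasType T (listEnv [θ]) E τ → size E ≤ n →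
      |conv (substTuple E [M]) - conv (substTuple E [N])| ≤ r := by
  have hs : ∀ {P : Term}, IsProgram T θ P →
      ∀ n σ, listEnv [θ] n = some σ → IsProgram T σ (tupleSubst [P] n) := by
    intro P hP n σ hn
    cases n with
    | zero => cases hn; exact hP
    | succ n => simp [listEnv] at hn
  -- The bound for the empty trace already forces this.
  have hr0 : 0 ≤ r := (abs_nonneg _).trans (hr [] .nil)
  have value : ∀ {V : Term} {Γ : Env Ty} {σ : Ty}, ValueLike False V → HasType T Γ V σ →
      ∀ s, IsValue (subst s V) := fun hV hVt s => hV.isValue_subst hVt fun hb => hb.elim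
  induction n using Nat.strong_induction_on with
  | _ n ih =>
  intro E τ h hn
  -- Here the variable stands for an unevaluated program and is not a value: in evaluation position
  -- it has to be evaluated.
  obtain hv | ⟨e, q, rfl, hq⟩ := h.decompose False _ le_rfl
  · rw [substTuple_eq, substTuple_eq, conv_value (value hv h _), conv_value (value hv h _),
      sub_self, abs_zero]
    exact hr0
  have hinv := e.plug_inv h
  cases hq with
  | omega =>
    rw [substTuple_eq, substTuple_eq, conv_subst_plug_omega h (hs hM),
      conv_subst_plug_omega h (hs hN), sub_self, abs_zero]
    exact hr0
  | @choice A B =>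
    have h₁ := ih (size (e.plug A)) ((e.size_plug_lt (by rw [size_choice]; omega)).trans_le hn)
      h.plug_choice.1 le_rfl
    have h₂ := ih (size (e.plug B)) ((e.size_plug_lt (by rw [size_choice]; omega)).trans_le hn)
      h.plug_choice.2 le_rfl
    rw [substTuple_eq, substTuple_eq] at h₁ h₂ ⊢
    rw [conv_subst_plug_choice h (hs hM), conv_subst_plug_choice h (hs hN)]
    rw [abs_le] at h₁ h₂ ⊢
    constructor <;> linarith
  | @beta L V hV =>
    have h₁ := ih _ (h.plug_beta.2.trans_le hn) h.plug_beta.1 le_rfl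
    obtain ⟨Δ, Θ, σ, hs₁, hM', -⟩ := hinv
    cases hM' with
    | app hs' hu h₃ h₄ =>
    rwa [substTuple_eq, substTuple_eq, ← conv_subst_plug_beta h (hs hM) (value hV h₄ _),
      ← conv_subst_plug_beta h (hs hN) (value hV h₄ _)] at h₁
  | @letPair V W L hV hW =>
    have h₁ := ih _ (h.plug_letPair.2.trans_le hn) h.plug_letPair.1 le_rfl
    obtain ⟨Δ, Θ, σ, hs₁, hM', -⟩ := hinv
    cases hM' with
    | letp hs' hu h₂ h₃ =>
    cases h₂ with
    | pair hp hu' h₄ h₅ =>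
    rwa [substTuple_eq, substTuple_eq,
      ← conv_subst_plug_letPair h (hs hM) (value hV h₄ _) (value hW h₅ _),
      ← conv_subst_plug_letPair h (hs hN) (value hV h₄ _) (value hW h₅ _)] at h₁
  | appVar hb => exact hb.elim
  | letVar hb => exact hb.elim
  | @var i _ =>
    obtain ⟨Δ, Θ, σ, hs₁, hM', hc, -⟩ := hinv
    cases hM' with
    | var hi =>
    have hi0 : i = 0 := by
      have := lt_length_of_getElem? (hs₁.left hi).1
      simpa using this
    subst hi0
    obtain rfl : θ = σ := Option.some.inj (hs₁.left hi).1
    -- By affinity the variable in evaluation position is not available to `e`, so `e` is the same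
    -- whether the program or one of its values is substituted.
    have hΘ : ∀ n, Θ n = none := by
      intro n
      cases n with
      | zero => exact (hs₁.left hi).2
      | succ n =>
        rcases hs₁ (n + 1) with k | k
        · exact k.2
        · exact k.2.trans rfl
    have key : ∀ P, IsProgram T θ P → conv (substTuple (e.plug (var 0)) [P]) =
        expect (bind (sem P) fun V => Finsupp.single [V] 1) fun K =>
          conv (substTuple (e.plug (var 0)) K) := by
      intro P hP
      rw [substTuple_eq, conv_subst_plug h (hs hP), expect_bind]
      simp only [expect_single, substTuple_eq, e.subst_plug]
      refine expect_congr fun V _ => ?_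
      rw [hc (tupleSubst [P]) (tupleSubst [V]) fun n hn => absurd (hΘ n) hn]
      rfl
    have typed : ∀ P, IsProgram T θ P →
        ∀ K ∈ (bind (sem P) fun V => (Finsupp.single [V] 1 : List Term →₀ ℝ)).support,
          TupTyped T [θ] K := by
      intro P hP K hK
      obtain ⟨V, hV, hK⟩ := exists_mem_support_of_mem_bind hK
      obtain rfl := Finset.mem_singleton.1 (Finsupp.support_single_subset hK)
      exact tupTyped_singleton (hP.of_mem_sem hV).1 (hP.of_mem_sem hV).2
    -- The difference of the two value distributions, moved to one-component tuples, is the signed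
    -- measure to which the non-expansive test is applied.
    rw [key M hM, key N hN, ← expect_sub]
    refine nonExpansive_conv _ h le_rfl _ r (fun K hK => ?_) fun s hst => ?_
    · classical
      rcases Finset.mem_union.1 (Finsupp.support_sub hK) with hK | hK
      · exact typed M hM K hK
      · exact typed N hN K hK
    · rw [expect_sub, expect_bind, expect_bind]
      simp only [expect_single]
      exact hr s hst

/-! ### Contexts as open terms -/

/-- The term obtained by filling the hole, outside of the binders, with the variable `d`. -/
def Ctx.toTerm : Ctx → ℕ → Term
  | .hole, d => var d
  | .term M, _ => M
  | .lam C, d => Term.lam (C.toTerm (d + 1))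
  | .appL C M, d => Term.app (C.toTerm d) M
  | .appR M C, d => Term.app M (C.toTerm d)
  | .choice C C', d => Term.choice (C.toTerm d) (C'.toTerm d)
  | .pairL C M, d => Term.pair (C.toTerm d) M
  | .pairR M C, d => Term.pair M (C.toTerm d)
  | .letL C M, d => Term.letp (C.toTerm d) M
  | .letR M C, d => Term.letp M (C.toTerm (d + 2))

namespace Env

theorem Split.update_left {Γ Δ Θ : Env Ty} (h : Split Γ Δ Θ) {d : ℕ} (hd : Γ d = none)
    (θ : Option Ty) : Split (Function.update Γ d θ) (Function.update Δ d θ) Θ := by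
  intro n
  by_cases hn : n = d
  · subst hn
    rcases h n with h | h <;> simp_all
  · simpa [hn] using h n

theorem cons_update (σ : Ty) (Γ : Env Ty) (d : ℕ) (θ : Option Ty) :
    cons σ (Function.update Γ d θ) = Function.update (cons σ Γ) (d + 1) θ := by
  funext n
  cases n with
  | zero => simp [cons, Function.update]
  | succ n => simp [cons, Function.update]

theorem Split.left_eq_none {Γ Δ Θ : Env Ty} (h : Split Γ Δ Θ) {d : ℕ} (hd : Γ d = none) :
    Δ d = none := by
  rcases h d with h | h <;> simp_all

theorem Split.right_eq_none {Γ Δ Θ : Env Ty} (h : Split Γ Δ Θ) {d : ℕ} (hd : Γ d = none) :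
    Θ d = none := h.symm.left_eq_none hd

end Env

/-- The hole becomes the variable `d`, absent from `Γ`. The contexts put it on one side of every
split and in both branches of a choice, exactly as an affine variable is allowed. -/
theorem CtxHasType.toTerm {θ : Ty} {Γ : Env Ty} {C : Ctx} {τ : Ty} (h : CtxHasType T θ Γ C τ) :
    ∀ {d : ℕ}, Γ d = none → HasType T (Function.update Γ d (some θ)) (C.toTerm d) τ := by
  induction h with
  | hole => intro d hd; exact .var (by simp)
  | @term Γ _ _ hM =>
    intro d hd
    refine hM.weaken fun n σ hn => ?_
    rw [Function.update_of_ne (by rintro rfl; simp [hd] at hn), hn]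
  | lam hu _ ih =>
    intro d hd
    refine .lam hu ?_
    rw [cons_update]
    exact ih hd
  | appL hs hu _ hN ih =>
    intro d hd
    exact .app (hs.update_left hd _) hu (ih (hs.left_eq_none hd)) hN
  | appR hs hu hM _ ih =>
    intro d hd
    exact .app (hs.symm.update_left hd _).symm hu hM (ih (hs.right_eq_none hd))
  | choice _ _ ih₁ ih₂ => intro d hd; exact .choice (ih₁ hd) (ih₂ hd)
  | pairL hs hu _ hN ih =>
    intro d hd
    exact .pair (hs.update_left hd _) hu (ih (hs.left_eq_none hd)) hN
  | pairR hs hu hM _ ih =>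
    intro d hd
    exact .pair (hs.symm.update_left hd _).symm hu hM (ih (hs.right_eq_none hd))
  | letL hs hu _ hN ih =>
    intro d hd
    exact .letp (hs.update_left hd _) hu (ih (hs.left_eq_none hd)) hN
  | letR hs hu hM _ ih =>
    intro d hd
    refine .letp (hs.symm.update_left hd _).symm hu hM ?_
    rw [cons_update, cons_update]
    exact ih (hs.right_eq_none hd)

theorem IsProgram.up_update {θ : Ty} {P : Term} (hP : IsProgram T θ P) (d : ℕ) :
    up (Function.update var d P) = Function.update var (d + 1) P := by
  funext n
  cases n with
  | zero => simp [up, Function.update]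
  | succ n =>
    by_cases hn : n = d
    · subst hn; simp [up, hP.rename_eq]
    · simp [up, hn, rename]

theorem HasType.subst_update_eq {Γ : Env Ty} {M : Term} {τ : Ty} (h : HasType T Γ M τ) {d : ℕ}
    (hd : Γ d = none) (P : Term) : Term.subst (Function.update Term.var d P) M = M := by
  refine (h.subst_congr fun n hn => ?_).trans (subst_var M)
  rw [Function.update_of_ne]
  rintro rfl
  exact hn hd

/-- As `P` is closed, nothing in it is captured or shifted by the binders above the hole, so filling
agrees with capture-avoiding substitution. -/
theorem CtxHasType.fill_eq {θ : Ty} {P : Term} (hP : IsProgram T θ P) {Γ : Env Ty} {C : Ctx}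
    {τ : Ty} (h : CtxHasType T θ Γ C τ) : ∀ {d : ℕ}, Γ d = none →
      C.fill P = Term.subst (Function.update var d P) (C.toTerm d) := by
  induction h with
  | hole => intro d hd; simp [Ctx.fill, Ctx.toTerm, Term.subst]
  | term hM => intro d hd; exact (hM.subst_update_eq hd P).symm
  | lam hu _ ih =>
    intro d hd
    rw [Ctx.fill, Ctx.toTerm, Term.subst, hP.up_update, ← ih (d := d + 1) hd]
  | appL hs hu _ hN ih =>
    intro d hd
    rw [Ctx.fill, Ctx.toTerm, Term.subst, ← ih (hs.left_eq_none hd),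
      hN.subst_update_eq (hs.right_eq_none hd)]
  | appR hs hu hM _ ih =>
    intro d hd
    rw [Ctx.fill, Ctx.toTerm, Term.subst, ← ih (hs.right_eq_none hd),
      hM.subst_update_eq (hs.left_eq_none hd)]
  | choice _ _ ih₁ ih₂ =>
    intro d hd
    rw [Ctx.fill, Ctx.toTerm, Term.subst, ← ih₁ hd, ← ih₂ hd]
  | pairL hs hu _ hN ih =>
    intro d hd
    rw [Ctx.fill, Ctx.toTerm, Term.subst, ← ih (hs.left_eq_none hd),
      hN.subst_update_eq (hs.right_eq_none hd)]
  | pairR hs hu hM _ ih =>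
    intro d hd
    rw [Ctx.fill, Ctx.toTerm, Term.subst, ← ih (hs.right_eq_none hd),
      hM.subst_update_eq (hs.left_eq_none hd)]
  | letL hs hu _ hN ih =>
    intro d hd
    rw [Ctx.fill, Ctx.toTerm, Term.subst, ← ih (hs.left_eq_none hd), hP.up_update, hP.up_update,
      hN.subst_update_eq (d := d + 2) (hs.right_eq_none hd)]
  | letR hs hu hM _ ih =>
    intro d hd
    rw [Ctx.fill, Ctx.toTerm, Term.subst, hP.up_update, hP.up_update,
      ← ih (d := d + 2) (hs.right_eq_none hd), hM.subst_update_eq (hs.left_eq_none hd)]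

theorem update_empty_eq_listEnv (θ : Ty) :
    Function.update (Env.empty : Env Ty) 0 (some θ) = listEnv [θ] := by
  funext n
  cases n with
  | zero => simp [listEnv]
  | succ n => simp [listEnv, Env.empty]

theorem tupleSubst_singleton (P : Term) : tupleSubst [P] = Function.update var 0 P := by
  funext n
  cases n with
  | zero => simp [tupleSubst]
  | succ n => simp [tupleSubst]

theorem CtxHasType.fill_eq_substTuple {θ : Ty} {P : Term} (hP : IsProgram T θ P) {C : Ctx}
    {τ : Ty} (h : CtxHasType T θ Env.empty C τ) : C.fill P = substTuple (C.toTerm 0) [P] := by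
  rw [substTuple_eq, tupleSubst_singleton]
  exact h.fill_eq hP rfl

theorem ctxDist_le_tupDist {θ : Ty} {M N : Term} (hM : IsProgram T θ M) (hN : IsProgram T θ N) :
    ctxDist T θ M N ≤ tupDist T θ M N := by
  -- Only a finite supremum can serve as the real bound `r` of `abs_conv_sub_le`.
  by_cases htop : tupDist T θ M N = ⊤
  · rw [htop]; exact le_top
  refine iSup₂_le fun C hC => ?_
  obtain ⟨τ, hC⟩ := hC
  rw [ENNReal.ofReal_le_iff_le_toReal htop, hC.fill_eq_substTuple hM, hC.fill_eq_substTuple hN]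
  refine abs_conv_sub_le hM hN (fun s hs => ?_) _ (update_empty_eq_listEnv θ ▸ hC.toTerm rfl) le_rfl
  rw [← ENNReal.ofReal_le_iff_le_toReal htop]
  exact le_iSup₂ (f := fun (s : List TupAct) (_ : TupTraceTyped T [θ] s) =>
    ENNReal.ofReal |expect (sem M) (fun V => tupProb s [V]) -
      expect (sem N) (fun W => tupProb s [W])|) s hs

/-! ### Traces as contexts -/

theorem CtxHasType.fill {θ : Ty} {P : Term} (hP : IsProgram T θ P) {C : Ctx}
    {τ : Ty} (h : CtxHasType T θ Env.empty C τ) : IsProgram T τ (C.fill P) := by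
  rw [h.fill_eq_substTuple hP]
  refine (update_empty_eq_listEnv θ ▸ h.toTerm rfl : HasType T (listEnv [θ]) _ τ).subst_program
    fun n σ hn => ?_
  cases n with
  | zero => cases hn; exact hP
  | succ n => simp [listEnv] at hn

theorem trProb_appl {P V : Term} {ρ σ τ : Ty} (hu : T.unfold ρ = .arrow σ τ)
    (hP : IsProgram T ρ P) (hv : IsValue V) (hV : IsProgram T σ V) (s : List TrAct) :
    trProb (app P V) s = trProb P (.appl V :: s) := by
  rw [trProb, trProb, sem_app (HasType.app (split_empty_right _) hu hP hV), expect_bind]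
  refine expect_congr fun U _ => ?_
  rw [sem_value hv, bind_single]
  cases U <;> rfl

theorem trProb_tens {P L : Term} {ρ σ τ γ : Ty} (hu : T.unfold ρ = .tensor σ τ)
    (hP : IsProgram T ρ P) (hL : HasType T (cons σ (cons τ Env.empty)) L γ) (s : List TrAct) :
    trProb (letp P L) s = trProb P (.tens L :: s) := by
  rw [trProb, trProb, sem_letp (HasType.letp (split_empty_right _) hu hP hL), expect_bind]
  refine expect_congr fun U _ => ?_
  cases U with
  | pair N K => simp only [letSem, valueTrProb, expect_bind]
  | _ => rfl

/-- The context `D` collects the actions performed so far: each action wraps `D` in an application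
or a `let`. Once the trace is empty, acceptance is the weight of the value distribution, that is,
convergence. -/
theorem TraceTyped.exists_ctx {θ ρ : Ty} {s : List TrAct} (h : TraceTyped T ρ s) :
    ∀ D, CtxHasType T θ Env.empty D ρ → ∃ C, (∃ τ, CtxHasType T θ Env.empty C τ) ∧
      ∀ P, IsProgram T θ P → conv (C.fill P) = trProb (D.fill P) s := by
  induction h with
  | nil => exact fun D hD => ⟨D, ⟨_, hD⟩, fun P _ => weight_eq_expect _⟩
  | appl hu hv hV _ ih =>
    intro D hD
    obtain ⟨C, hC, hCP⟩ := ih (.appL D _) (.appL (split_empty_right _) hu hD hV)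
    exact ⟨C, hC, fun P hP => (hCP P hP).trans (trProb_appl hu (hD.fill hP) hv hV _)⟩
  | tens hu hL _ ih =>
    intro D hD
    obtain ⟨C, hC, hCP⟩ := ih (.letL D _) (.letL (split_empty_right _) hu hD hL)
    exact ⟨C, hC, fun P hP => (hCP P hP).trans (trProb_tens hu (hD.fill hP) hL _)⟩

theorem trDist_le_ctxDist {θ : Ty} {M N : Term} (hM : IsProgram T θ M) (hN : IsProgram T θ N) :
    trDist T θ M N ≤ ctxDist T θ M N := by
  refine iSup₂_le fun s hs => ?_
  obtain ⟨C, hC, hCP⟩ := hs.exists_ctx .hole .hole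
  refine le_iSup₂_of_le C hC (le_of_eq ?_)
  rw [hCP M hM, hCP N hN]
  rfl

/-! ### Tuple traces as open terms -/

theorem inst_subst_up (V X : Term) (s : ℕ → Term) :
    inst (subst (up s) X) V = subst (scons V s) X := by
  rw [inst, subst_subst]
  congr 1
  funext n
  cases n with
  | zero => rfl
  | succ n => simp only [Function.comp, up, scons, subst_rename]; exact subst_var _

theorem inst₂_subst_up (V W X : Term) (s : ℕ → Term) :
    inst₂ (subst (up (up s)) X) V W = subst (scons V (scons W s)) X := by
  rw [inst₂, subst_subst]
  congr 1
  funext n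
  rcases n with _ | _ | n
  · rfl
  · rfl
  · simp only [Function.comp, up, scons, subst_rename]; exact subst_var _

/-- The term is `let ⟨x, y⟩ = xᵢ in L`, with the variables of `L` renamed. -/
theorem exists_term_cut {S : List Ty} {i : ℕ} {ρ σ τ γ : Ty} {L : Term} (hi : S[i]? = some ρ)
    (hu : T.unfold ρ = .tensor σ τ) (hL : HasType T (listEnv (splitAt S i σ τ)) L γ) :
    ∃ L', HasType T (listEnv S) L' γ ∧ ∀ K, TupTyped T S K →
      conv (substTuple L' K) =
        expect (tupStep K (.cut i)) fun K' => conv (substTuple L K') := by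
  -- The two new components become the bound variables 0 and 1. Earlier positions are shifted by the
  -- two binders; a later one was `m - 1` before the split, so it becomes `m + 1`.
  set t : ℕ → ℕ := fun m =>
    if m < i then m + 2 else if m = i then 0 else if m = i + 1 then 1 else m + 1 with ht
  have hX : HasType T (cons σ (cons τ ((listEnv S).restrict fun n => ¬ n = i))) (rename t L) γ := by
    refine hL.rename (o := fun m => match m with
      | 0 => i
      | 1 => i + 1
      | k + 2 => if k < i then k else k + 1) fun m δ hm => ?_
    unfold listEnv at hm
    rw [getElem?_splitAt (lt_length_of_getElem? hi)] at hm
    simp only [ht]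
    split_ifs at hm ⊢ with h₁ h₂ h₃
    · exact ⟨(restrict_eq_some (Γ := listEnv S) (A := fun n => ¬ n = i)
        (n := m)).2 ⟨h₁.ne, hm⟩, if_pos h₁⟩
    · exact ⟨hm, h₂.symm⟩
    · exact ⟨hm, h₃.symm⟩
    · obtain ⟨k, rfl⟩ : ∃ k, m = k + 1 := ⟨m - 1, by omega⟩
      exact ⟨(restrict_eq_some (Γ := listEnv S) (A := fun n => ¬ n = i)
        (n := k)).2 ⟨by omega, hm⟩, if_neg (by omega)⟩
  have hT : HasType T (listEnv S) (letp (var i) (rename t L)) γ :=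
    .letp (split_restrict _ fun n => n = i) hu (.var (restrict_eq_some.2 ⟨rfl, hi⟩)) hX
  refine ⟨_, hT, fun K hK => ?_⟩
  obtain ⟨N₁, N₂, hN, hN₁, hN₂⟩ := hK.exists_pair hi hu
  have hp := hK.substTuple hT
  rw [expect_tupStep_cut hN]
  rw [substTuple_eq, subst, subst, tupleSubst_of_getElem? hN] at hp ⊢
  rw [conv, sem_letp_value (V := pair N₁ N₂) trivial hp, letSem, weight_eq_expect, expect_bind]
  refine expect_congr fun V hV => ?_
  rw [expect_bind]
  refine expect_congr fun W hW => ?_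
  have e : inst₂ (subst (up (up (tupleSubst K))) (rename t L)) V W =
      substTuple L (splitAt K i V W) := by
    rw [inst₂_subst_up, subst_rename, substTuple_eq]
    refine hL.subst_congr fun m hm => ?_
    obtain ⟨δ, hδ⟩ := Option.ne_none_iff_exists'.1 hm
    obtain ⟨V', hV', -⟩ := hK.splitAt hi (hN₁.of_mem_sem hV).1 (hN₁.of_mem_sem hV).2
      (hN₂.of_mem_sem hW).1 (hN₂.of_mem_sem hW).2 m δ hδ
    rw [tupleSubst_of_getElem? hV', Function.comp]
    rw [getElem?_splitAt (lt_length_of_getElem? hN)] at hV'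
    simp only [ht]
    split_ifs at hV' ⊢
    · exact tupleSubst_of_getElem? hV'
    · exact Option.some.inj hV'
    · exact Option.some.inj hV'
    · obtain ⟨k, rfl⟩ : ∃ k, m = k + 1 := ⟨m - 1, by omega⟩
      exact tupleSubst_of_getElem? hV'
  rw [e, conv, weight_eq_expect]

/-- The term is `(λz. L)(xᵢ C)`: call-by-value application evaluates `xᵢ C` and hands its value to
`L`. -/
theorem exists_term_appl {S : List Ty} {G : Finset ℕ} {C : Term} {i : ℕ} {ρ σ τ γ : Ty}
    {L : Term} (hi : S[i]? = some ρ) (hu : T.unfold ρ = .arrow σ τ) (hiG : i ∉ G)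
    (hv : IsOpenValue C) (hC : HasType T (fun j => if j ∈ G then S[j]? else none) C σ)
    (hL : HasType T (listEnv (contractAt S G i τ)) L γ) :
    ∃ L', HasType T (listEnv S) L' γ ∧ ∀ K, TupTyped T S K →
      conv (substTuple L' K) =
        expect (tupStep K (.appl G C i)) fun K' => conv (substTuple L K') := by
  classical
  -- A type for `λz. L`; this is why type systems are required to have all affine function types.
  obtain ⟨ρ', hu'⟩ := T.exists_arrow τ γ
  -- The result in position `i` becomes the bound variable, and the surviving components return to
  -- their old positions, shifted by one binder.
  set t : ℕ → ℕ := fun m => if oldPos G m = i then 0 else oldPos G m + 1 with ht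
  set Δ := (listEnv S).restrict fun n => ¬ (n ∉ G ∧ n ≠ i) with hΔ
  have hX : HasType T (cons τ ((listEnv S).restrict fun n => n ∉ G ∧ n ≠ i)) (rename t L) γ := by
    refine hL.rename (o := fun m => match m with
      | 0 => newPos G i
      | k + 1 => newPos G k) fun m δ hm => ?_
    unfold listEnv at hm
    rw [getElem?_contractAt (lt_length_of_getElem? hi) hiG] at hm
    have hnew := newPos_oldPos G m
    simp only [ht]
    split_ifs at hm ⊢ with h₁
    · exact ⟨hm, h₁ ▸ hnew⟩
    · exact ⟨(restrict_eq_some (Γ := listEnv S) (A := fun n => n ∉ G ∧ n ≠ i)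
        (n := oldPos G m)).2 ⟨⟨oldPos_notMem G m, h₁⟩, hm⟩, hnew⟩
  have hA : HasType T Δ (app (var i) C) τ := by
    refine .app (split_restrict _ fun n => n = i) hu
      (.var (restrict_eq_some.2 ⟨rfl, restrict_eq_some.2 ⟨by simp, hi⟩⟩))
      (hC.weaken fun n δ hn => ?_)
    split_ifs at hn with h
    exact restrict_eq_some.2 ⟨fun hni => hiG (hni ▸ h), restrict_eq_some.2 ⟨by simp [h], hn⟩⟩
  -- Writing the term as a plugged evaluation context lets `conv_subst_plug` evaluate the argument
  -- first.
  have hT : HasType T (listEnv S)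
      ((EvalCtx.appR (lam (rename t L)) .hole).plug (app (var i) C)) γ :=
    .app (split_restrict _ _) hu' (.lam hu' hX) hA
  refine ⟨_, hT, fun K hK => ?_⟩
  obtain ⟨N, hN, hNt⟩ := hK.exists_lam hi hu
  have hAp : IsProgram T τ (subst (tupleSubst K) (app (var i) C)) :=
    hA.subst_program fun n δ hn => hK.program n δ (restrict_eq_some.1 hn).2
  have hXp : IsProgram T ρ' (subst (tupleSubst K) (lam (rename t L))) :=
    (HasType.lam hu' hX).subst_program fun n δ hn => hK.program n δ (restrict_eq_some.1 hn).2
  have hCv : IsValue (substTuple C K) := by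
    refine ValueLike.isValue_subst (b := True) (by cases C <;> trivial) hC fun _ n δ hn => ?_
    split_ifs at hn
    exact hK.isValue hn
  have hsem : sem (subst (tupleSubst K) (app (var i) C)) = sem (inst N (substTuple C K)) := by
    rw [subst, subst, tupleSubst_of_getElem? hN] at hAp ⊢
    exact sem_app_value (V := lam N) trivial hCv hAp
  rw [expect_tupStep_appl hN, substTuple_eq, conv_subst_plug hT hK.program, ← hsem]
  refine expect_congr fun W hW => ?_
  obtain ⟨k₁, k₂⟩ := hAp.of_mem_sem hW
  have e : inst (subst (up (tupleSubst K)) (rename t L)) W =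
      substTuple L (contractAt K G i W) := by
    rw [inst_subst_up, subst_rename, substTuple_eq]
    refine hL.subst_congr fun m hm => ?_
    obtain ⟨δ, hδ⟩ := Option.ne_none_iff_exists'.1 hm
    obtain ⟨V', hV', -⟩ := hK.contractAt hiG hi k₁ k₂ m δ hδ
    rw [tupleSubst_of_getElem? hV', Function.comp]
    rw [getElem?_contractAt (lt_length_of_getElem? hN) hiG] at hV'
    simp only [ht]
    split_ifs at hV' ⊢
    · exact Option.some.inj hV'
    · exact tupleSubst_of_getElem? hV'
  have hp := HasType.app (split_empty_right _) hu' hXp k₂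
  simp only [EvalCtx.subst, EvalCtx.plug, subst] at hp ⊢
  rw [conv, sem_app_value (V := lam _) trivial k₁ hp, appSem, e, conv]

/-- Every tuple trace is performed by an open term. -/
theorem TupTraceTyped.exists_term (θ : Ty) {S : List Ty} {s : List TupAct}
    (h : TupTraceTyped T S s) : ∃ L γ, HasType T (listEnv S) L γ ∧
      ∀ K, TupTyped T S K → conv (substTuple L K) = tupProb s K := by
  induction h with
  | nil =>
    -- Any term that always converges will do; `θ` only provides a type at which the identity is
    -- typed.
    obtain ⟨ρ, hu⟩ := T.exists_arrow θ θ
    exact ⟨lam (var 0), ρ, .lam hu (.var rfl), fun K _ => conv_value trivial⟩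
  | @cut S i ρ σ τ s hi hu _ ih =>
    obtain ⟨L, γ, hL, hLK⟩ := ih
    obtain ⟨L', hL', h⟩ := exists_term_cut hi hu hL
    refine ⟨L', γ, hL', fun K hK => (h K hK).trans (expect_congr fun K' hK' => hLK K' ?_)⟩
    obtain ⟨N₁, N₂, hN, hN₁, hN₂⟩ := hK.exists_pair hi hu
    obtain ⟨V, hV, W, hW, rfl⟩ := mem_tupStep_cut hN hK'
    exact hK.splitAt hi (hN₁.of_mem_sem hV).1 (hN₁.of_mem_sem hV).2
      (hN₂.of_mem_sem hW).1 (hN₂.of_mem_sem hW).2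
  | @appl S G C i ρ σ τ s hi hu hG hv hC _ ih =>
    obtain ⟨L, γ, hL, hLK⟩ := ih
    have hiG : i ∉ G := fun h => (hG i h).2 rfl
    obtain ⟨L', hL', h⟩ := exists_term_appl hi hu hiG hv hC hL
    refine ⟨L', γ, hL', fun K hK => (h K hK).trans (expect_congr fun K' hK' => hLK K' ?_)⟩
    obtain ⟨N, hN, hNt⟩ := hK.exists_lam hi hu
    obtain ⟨W, hW, rfl⟩ := mem_tupStep_appl hN hK'
    have hCp : IsProgram T σ (substTuple C K) := hC.subst_program fun n δ hn => by
      split_ifs at hn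
      exact hK.program n δ hn
    obtain ⟨k₁, k₂⟩ := (hNt.inst_program hCp).of_mem_sem hW
    exact hK.contractAt hiG hi k₁ k₂

/-- Every tuple trace on a single value has the probability of some trace. -/
theorem TupTraceTyped.exists_trace {S : List Ty} {s : List TupAct} (h : TupTraceTyped T S s) :
    ∀ ρ, S = [ρ] → ∃ t, TraceTyped T ρ t ∧
      ∀ V, IsValue V → IsProgram T ρ V → valueTrProb t V = tupProb s [V] := by
  induction h with
  | nil => exact fun ρ _ => ⟨[], .nil, fun V _ _ => by simp [valueTrProb, tupProb]⟩
  | @cut S i ρ' σ τ s hi hu hs _ =>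
    rintro ρ rfl
    obtain rfl : i = 0 := by simpa using lt_length_of_getElem? hi
    obtain rfl : ρ = ρ' := Option.some.inj hi
    -- After a cut the tuple has two components, so the induction hypothesis is of no use; the whole
    -- remaining trace becomes the term `L`, and its success is the convergence of `L`.
    obtain ⟨L, γ, hL, hLK⟩ := hs.exists_term ρ
    have hL' : HasType T (cons σ (cons τ Env.empty)) L γ := hL.weaken fun n δ hn => by
      rcases n with _ | _ | n
      · exact hn
      · exact hn
      · simp [listEnv, splitAt] at hn
    refine ⟨[.tens L], .tens hu hL' .nil, fun V hv hV => ?_⟩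
    obtain ⟨N, K, rfl⟩ := hV.eq_pair hv hu
    obtain ⟨hN, hK⟩ := HasType.pair_inv hV hu
    rw [tupProb, expect_tupStep_cut rfl, valueTrProb]
    refine expect_congr fun V hV' => expect_congr fun W hW => ?_
    rw [← hLK _ ((tupTyped_singleton hv hV).splitAt hi (hN.of_mem_sem hV').1
      (hN.of_mem_sem hV').2 (hK.of_mem_sem hW).1 (hK.of_mem_sem hW).2), conv, weight_eq_expect]
    have e : inst₂ L V W = substTuple L (splitAt [pair N K] 0 V W) :=
      hL.subst_congr fun n hn => by
        rcases n with _ | _ | n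
        · rfl
        · rfl
        · simp [listEnv, splitAt] at hn
    rw [e]
    exact expect_congr fun U _ => by simp [valueTrProb]
  | @appl S G C i ρ' σ τ s hi hu hG hv hC _ ih =>
    rintro ρ rfl
    obtain rfl : i = 0 := by simpa using lt_length_of_getElem? hi
    obtain rfl : ρ = ρ' := Option.some.inj hi
    -- With a single component, which is the function itself, the argument can use no other one and
    -- is a closed value.
    obtain rfl : G = ∅ := by
      refine Finset.eq_empty_of_forall_notMem fun j hj => ?_
      have := hG j hj
      simp at this
    have hC' : IsProgram T σ C := hC.weaken fun n δ hn => by simp at hn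
    have hCv : IsValue C := by
      cases C with
      | var n => cases hC' with | var h => exact nomatch h
      | lam => trivial
      | pair => trivial
      | _ => exact hv.elim
    obtain ⟨t, ht, hts⟩ := ih τ (by simp [contractAt])
    refine ⟨.appl C :: t, .appl hu hCv hC' ht, fun V hv hV => ?_⟩
    obtain ⟨N, rfl⟩ := hV.eq_lam hv hu
    rw [tupProb, expect_tupStep_appl rfl, valueTrProb, substTuple_eq, hC'.subst_eq]
    refine expect_congr fun W hW => ?_
    obtain ⟨k₁, k₂⟩ := ((HasType.lam_inv hV hu).inst_program hC').of_mem_sem hW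
    rw [hts W k₁ k₂]
    simp [contractAt]

theorem tupDist_le_trDist {θ : Ty} {M N : Term} (hM : IsProgram T θ M) (hN : IsProgram T θ N) :
    tupDist T θ M N ≤ trDist T θ M N := by
  refine iSup₂_le fun s hs => ?_
  obtain ⟨t, ht, hts⟩ := hs.exists_trace θ rfl
  refine le_iSup₂_of_le t ht (le_of_eq ?_)
  have key : ∀ P, IsProgram T θ P → expect (sem P) (fun V => tupProb s [V]) = trProb P t :=
    fun P hP => expect_congr fun V hV =>
      (hts V (hP.of_mem_sem hV).1 (hP.of_mem_sem hV).2).symm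
  rw [key M hM, key N hN]

end AffineLambda

end


theorem mainTheorem5 {Ty : Type*} (T : AffineLambda.TypeSystem Ty) (θ : Ty)
    (M N : AffineLambda.Term)
    (hM : AffineLambda.IsProgram T θ M) (hN : AffineLambda.IsProgram T θ N) :
    AffineLambda.tupDist T θ M N = AffineLambda.ctxDist T θ M N ∧
      AffineLambda.tupDist T θ M N = AffineLambda.trDist T θ M N := by
  have h₁ := AffineLambda.tupDist_le_trDist hM hN
  have h₂ := AffineLambda.trDist_le_ctxDist hM hN
  have h₃ := AffineLambda.ctxDist_le_tupDist hM hN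
  exact ⟨le_antisymm (h₁.trans h₂) h₃, le_antisymm h₁ (h₂.trans h₃)⟩
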